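/- Let $p$ be a prime, $k$ an algebraically closed field of characteristic $p$, $n\ge 0$, and let $G\cong(\mathbb Z/p)^n$ be a group of $k$-algebra automorphisms of $k[[z]]$, with $k[[t]]=k[[z]]^G$. The conductor of a $\mathbb Z/p$-extension of $k((t))$ is $\deg f+1$, where the extension is given by an Artin–Schreier equation $w^p-w=f(1/u)$ with $u$ a uniformizer of $k[[t]]$ and $f$ a polynomial over $k$ of degree prime to $p$. Let $(m_1,\dots,m_n)$ be the lexicographically smallest $n$-tuple of integers for which there are subgroups $G_1,\dots,G_n\subset G$ of index $p$ such that the $\mathbb Z/p$-extensions $k((z))^{G_i}/k((t))$ have conductors $m_i+1$ and the fields $k((z))^{G_1},\dots,k((z))^{G_n}$ are (jointly) linearly disjoint over $k((t))$; fix such $G_1,\dots,G_n$ (that is, $k[[z]]/k[[t]]$ is a $G$-cover of type $(m_1+1,\dots,m_n+1)$ with respect to $G_1,\dots,G_n$). For $j\ge 0$ let $I_j=\{\sigma\in G:\sigma(x)-x\in z^{j+1}k[[z]]\text{ for all }x\in k[[z]]\}$ be the $j$-th lower ramification group. For $0\le l\le n-1$, the $l$-th lower ramification jump of $k((z))/k((t))$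 is the positive integer $j$ such that $I_j$ has $p$-rank at least $n-l$ and $I_{j+1}$ has $p$-rank at most $n-l-1$. Then for every $0\le l\le n-1$ the $l$-th lower ramification jump exists, is unique, and equals $$p^l m_{l+1}-(p-1)\sum_{1\le i\le l}p^{i-1}m_i .$$ Consequently the special different of the cover, i.e. the degree of the different of $k[[z]]/k[[t]]$ (the exponent $d$ such that the different is $z^d k[[z]]$), equals $$(p-1)\sum_{l=0}^{n-1}p^l(m_{l+1}+1).$$ -/

import Mathlib

open scoped PowerSeries LaurentSeries

noncomputable section

namespace LocalCover

variable {k : Type*} [Field k]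

/-- The extension of a `k`-algebra automorphism of `k[[z]]` to its fraction field `k((z))`. -/
def extendAut (σ : k⟦X⟧ ≃ₐ[k] k⟦X⟧) : k⸨X⸩ ≃+* k⸨X⸩ :=
  IsFractionRing.ringEquivOfRingEquiv σ.toRingEquiv

/-- The ring of invariants `k[[z]]^G` of a group `G` of automorphisms of `k[[z]]`. -/
abbrev invariants (G : Subgroup (k⟦X⟧ ≃ₐ[k] k⟦X⟧)) : Subalgebra k k⟦X⟧ :=
  FixedPoints.subalgebra k k⟦X⟧ G

/-- The field `k((z))^G = Frac (k[[z]]^G)`. -/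
def invariantField (G : Subgroup (k⟦X⟧ ≃ₐ[k] k⟦X⟧)) : Subfield k⸨X⸩ where
  carrier := {x | ∀ σ ∈ G, extendAut σ x = x}
  mul_mem' hx hy σ hσ := by rw [map_mul, hx σ hσ, hy σ hσ]
  one_mem' σ _ := map_one _
  add_mem' hx hy σ hσ := by rw [map_add, hx σ hσ, hy σ hσ]
  zero_mem' σ _ := map_zero _
  neg_mem' hx σ hσ := by rw [map_neg, hx σ hσ]
  inv_mem' x hx σ hσ := by rw [map_inv₀, hx σ hσ]

/-- The field `k((z))^N = Frac (k[[z]]^N)`, for `N` a subgroup of `G`, as an extension of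
`k((z))^G` inside `k((z))`. -/
def subcover (G : Subgroup (k⟦X⟧ ≃ₐ[k] k⟦X⟧)) (N : Subgroup G) :
    IntermediateField (invariantField G) k⸨X⸩ :=
  Subfield.extendScalars (F := invariantField G) (E := invariantField (N.map G.subtype))
    fun _ hx σ hσ => hx σ (Subgroup.map_subtype_le N hσ)

/-- The extension `k((z))^N / k((z))^G` is given by an Artin-Schreier equation
`w ^ p - w = f (1 / t)` with `t` a uniformizer of `k[[z]]^G` (so `k[[z]]^G = k[[t]]`), and `f` a
polynomial whose degree is prime to `p`, and `c = deg f + 1`. -/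
def HasConductor (p : ℕ) (G : Subgroup (k⟦X⟧ ≃ₐ[k] k⟦X⟧)) (N : Subgroup G) (c : ℕ) : Prop :=
  ∃ (t : invariants G) (f : Polynomial k) (w : k⸨X⸩),
    Irreducible t ∧ ¬ p ∣ f.natDegree ∧ c = f.natDegree + 1 ∧
    w ^ p - w = f.eval₂ HahnSeries.C (algebraMap k⟦X⟧ k⸨X⸩ (t : k⟦X⟧))⁻¹ ∧
    IntermediateField.adjoin (invariantField G) {w} = subcover G N

/-- The subgroups `N 0, …, N (n - 1)` of `G` have index `p`, the corresponding `p`-cyclic extensions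
of `k((z))^G` have conductors `m i + 1`, and they are (jointly) linearly disjoint: each one is
linearly disjoint from the compositum of the preceding ones. -/
structure IsAdmissible (p : ℕ) {n : ℕ} (G : Subgroup (k⟦X⟧ ≃ₐ[k] k⟦X⟧))
    (m : Fin n → ℕ) (N : Fin n → Subgroup G) : Prop where
  index_eq : ∀ i, (N i).index = p
  conductor : ∀ i, HasConductor p G (N i) (m i + 1)
  linearDisjoint : ∀ i,
    (⨆ j : Fin n, ⨆ _ : j < i, subcover G (N j)).LinearDisjoint (subcover G (N i))

/-- `k[[z]] / k[[z]]^G` is a cover of type `(m 0 + 1, …, m (n - 1) + 1)` with respect to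
`N 0, …, N (n - 1)`: the tuple `m` is lexicographically smallest among the tuples that admit
subgroups as in `IsAdmissible`, and the `N i` are such subgroups for `m`. -/
structure IsCoverOfType (p : ℕ) {n : ℕ} (G : Subgroup (k⟦X⟧ ≃ₐ[k] k⟦X⟧))
    (m : Fin n → ℕ) (N : Fin n → Subgroup G) : Prop where
  admissible : IsAdmissible p G m N
  lex_le : ∀ (m' : Fin n → ℕ) (N' : Fin n → Subgroup G),
    IsAdmissible p G m' N' → toLex m ≤ toLex m'

/-- The `j`-th ramification group of `k((z)) / k((z))^G` in lower numbering: the elements of `G`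
that act trivially on `k[[z]] / (z ^ (j + 1))`. -/
def lowerRamificationGroup (G : Subgroup (k⟦X⟧ ≃ₐ[k] k⟦X⟧)) (j : ℕ) : Subgroup G :=
  (IsLocalRing.maximalIdeal k⟦X⟧ ^ (j + 1)).toAddSubgroup.inertia G

/-- The `p`-rank of a finite group: the largest `r` such that it contains a copy of `(ℤ/p)^r`. -/
def pRank (p : ℕ) (H : Type*) [Group H] : ℕ :=
  sSup {r : ℕ | ∃ f : Multiplicative (Fin r → ZMod p) →* H, Function.Injective f}

/-- For `G ≅ (ℤ/p)^n` and `i < n`: `j` is an `i`-th lower ramification jump of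
`k((z)) / k((z))^G`. -/
def IsLowerJump (p n : ℕ) (G : Subgroup (k⟦X⟧ ≃ₐ[k] k⟦X⟧)) (i j : ℕ) : Prop :=
  0 < j ∧ n - i ≤ pRank p (lowerRamificationGroup G j) ∧
    pRank p (lowerRamificationGroup G (j + 1)) ≤ n - i - 1

end LocalCover

end

/-! Put D(σ) = ord(σ(z) - z) and Φ(x) = Σ_σ min(x, D(σ)), a rescaled Herbrand function. For a
hyperplane N of G whose Artin–Schreier extension has conductor c + 1, the inverse of an
Artin–Schreier generator is an N-invariant power series of known order. Comparing it with a
uniformizer of k[[z]]^N gives Σ_{h ∈ N} D(sh) = |N|(c + 1) for every s outside N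
(`sum_order_of_hasConductor`). As D is a filtration, this says Φ(max of D off N) = |G|(c + 1)
(`herbrandSum_of_coset_sums`), and Φ increases strictly. So the conductor of N measures the deepest
ramification outside N.

The characters of the fixed subgroups identify G with (ℤ/p)^n. An exchange argument turns
lexicographic minimality into a bound (`IsCoverOfType.le_conductor`): a hyperplane whose equation
involves some coordinate of index at least l has conductor at least m_l + 1. This forces D(v) to
depend only on the index l of the first nonzero coordinate of v, with nondecreasing values M_l.

With indices from 0, Φ is then linear of slope p^(n-l-1) between M_l and M_(l+1), while Φ(M_l) = p^n
(m_l + 1). Hence M_0 = m_0 + 1 and M_(l+1) - M_l = p^(l+1) (m_(l+1) - m_l), which sums to the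
formula; the l-th lower jump is M_l - 1 (`isLowerJump_iff`). Since k[[z]] is generated by z over the
invariants, the different has exponent Σ_{σ ≠ 1} D(σ) = Φ(M_(n-1)) - M_(n-1) when n > 0. -/

section Combinatorics

/-! ### Combinatorics of filtrations on (ℤ/p)^n. -/

open Finset

/-- The sum `∑ g, min x (D g)`; for the ramification function `D` of a finite group this is
`|G|` times one plus the Herbrand function, up to a shift of the argument. -/
def herbrandSum {V : Type*} [Fintype V] (D : V → ℕ) (x : ℕ) : ℕ := ∑ g, min x (D g)

theorem herbrandSum_lt {V : Type*} [Fintype V] {D : V → ℕ} {x y : ℕ} (h : x < y) (v : V)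
    (hv : y ≤ D v) : herbrandSum D x < herbrandSum D y :=
  sum_lt_sum (fun _ _ => min_le_min_right _ h.le) ⟨v, mem_univ _, by omega⟩

open Classical in
/-- If `D` has average `C` over every nontrivial coset of `N`, then `herbrandSum D` takes the value
`|V| * C` at the maximum of `D` off `N`. -/
theorem herbrandSum_of_coset_sums {V : Type*} [AddCommGroup V] [Fintype V] (D : V → ℕ)
    (hadd : ∀ u v, min (D u) (D v) ≤ D (u + v)) (hneg : ∀ v, D (-v) = D v)
    (N : AddSubgroup V) (C : ℕ)
    (hsum : ∀ s, s ∉ N → ∑ h with h ∈ N, D (s + h) = #{h | h ∈ N} * C)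
    {s : V} (hs : s ∉ N) (hmax : ∀ g, g ∉ N → D g ≤ D s) :
    herbrandSum D (D s) = Fintype.card V * C := by
  have hpos : 0 < #{h | h ∈ N} := card_pos.2 ⟨0, by simp [N.zero_mem]⟩
  have hmem : ∀ g h, h ∈ N → (g + h ∉ N ↔ g ∉ N) := fun g h hh => by
    rw [N.add_mem_cancel_right hh]
  -- By maximality D (s + h) ≤ D s, so the ultrametric inequality gives min (D s) (D h) = D (s + h):
  -- N contributes as much as the coset s + N.
  have h1 : ∑ h with h ∈ N, min (D s) (D h) = #{h | h ∈ N} * C := by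
    rw [← hsum s hs]
    refine sum_congr rfl fun h hh => ?_
    have hh' : h ∈ N := (mem_filter.1 hh).2
    have a1 := hadd s h
    have a2 := hmax (s + h) ((hmem s h hh').2 hs)
    have a3 := hadd (s + h) (-s)
    rw [hneg, show s + h + -s = h by abel] at a3
    omega
  have h2 : ∑ h with h ∉ N, min (D s) (D h) = #{h | h ∉ N} * C := by
    have e1 : ∑ h with h ∉ N, min (D s) (D h) = ∑ h with h ∉ N, D h :=
      sum_congr rfl fun h hh => min_eq_right (hmax h (mem_filter.1 hh).2)
    rw [e1]
    -- Multiplying by |N| allows summing over translates by N instead of choosing coset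
    -- representatives.
    refine Nat.eq_of_mul_eq_mul_left hpos ?_
    calc #{h | h ∈ N} * ∑ g with g ∉ N, D g
        = ∑ h with h ∈ N, ∑ g with g ∉ N, D (g + h) := by
          rw [← smul_eq_mul, ← sum_const]
          refine sum_congr rfl fun h hh => ?_
          refine (sum_equiv (Equiv.addRight h) (fun g => ?_) fun g _ => rfl).symm
          simp [hmem g h (mem_filter.1 hh).2]
      _ = ∑ g with g ∉ N, ∑ h with h ∈ N, D (g + h) := sum_comm
      _ = ∑ g with g ∉ N, #{h | h ∈ N} * C :=
          sum_congr rfl fun g hg => hsum g (mem_filter.1 hg).2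
      _ = #{h | h ∈ N} * (#{h | h ∉ N} * C) := by
          rw [sum_const, smul_eq_mul]; ring
  rw [herbrandSum, ← sum_filter_add_sum_filter_not univ (fun h => h ∈ N), h1, h2, ← add_mul,
    card_filter_add_card_filter_not, card_univ]

theorem card_filter_vanishing {F : Type*} [Fintype F] [DecidableEq F] [Zero F] (n l : ℕ) :
    #{v : Fin n → F | ∀ r : Fin n, (r : ℕ) < l → v r = 0} = Fintype.card F ^ (n - l) := by
  classical
  have : ({v : Fin n → F | ∀ r : Fin n, (r : ℕ) < l → v r = 0} : Finset (Fin n → F)) =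
      Fintype.piFinset fun r : Fin n => if (r : ℕ) < l then {0} else univ := by
    ext v
    simp only [mem_filter, mem_univ, true_and, Fintype.mem_piFinset]
    refine forall_congr' fun r => ?_
    split_ifs with h <;> simp [h]
  rw [this, Fintype.card_piFinset]
  have h2 : ∀ r : Fin n, #(if (r : ℕ) < l then ({0} : Finset F) else univ) =
      if (r : ℕ) < l then 1 else Fintype.card F := fun r => by
    split_ifs <;> simp [card_univ]
  simp only [h2, prod_ite, prod_const_one, one_mul, prod_const]
  congr 1
  have h3 := card_filter_add_card_filter_not (s := (univ : Finset (Fin n)))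
    (fun r : Fin n => (r : ℕ) < l)
  have h4 : #{r : Fin n | (r : ℕ) < l} = min n l := Fin.card_filter_val_lt
  rw [card_univ, Fintype.card_fin] at h3
  omega

theorem exists_first_ne_zero {F : Type*} [Zero F] {n : ℕ} {v : Fin n → F} (hv : v ≠ 0) :
    ∃ l, v l ≠ 0 ∧ ∀ r < l, v r = 0 := by
  classical
  obtain ⟨i, hi⟩ := Function.ne_iff.1 hv
  have hne : (univ.filter fun i => v i ≠ 0).Nonempty := ⟨i, by simpa using hi⟩
  refine ⟨_, (mem_filter.1 (min'_mem _ hne)).2, fun r hr => ?_⟩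
  by_contra h
  exact absurd (min'_le _ r (by simpa using h)) (not_le.2 hr)

theorem exists_dotProduct_separating {p : ℕ} [Fact p.Prime] {n : ℕ}
    (I : AddSubgroup (Fin n → ZMod p)) {v : Fin n → ZMod p} (hv : v ∉ I) :
    ∃ a : Fin n → ZMod p, a ⬝ᵥ v ≠ 0 ∧ ∀ g ∈ I, a ⬝ᵥ g = 0 := by
  obtain ⟨f, hf, hI⟩ := Submodule.exists_le_ker_of_notMem
    (p := AddSubgroup.toZModSubmodule p I) (v := v) (by simpa using hv)
  have key : ∀ x, (fun i => f (Pi.single i 1)) ⬝ᵥ x = f x := fun x => by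
    rw [LinearMap.pi_apply_eq_sum_univ f x, dotProduct]
    refine sum_congr rfl fun i _ => ?_
    rw [smul_eq_mul, mul_comm]
    congr 2
    ext j
    simp [Pi.single_apply, eq_comm]
  refine ⟨fun i => f (Pi.single i 1), by rwa [key], fun g hg => ?_⟩
  rw [key]
  exact hI (by simpa using hg)

theorem sum_Iio_eq_sum_range {n : ℕ} {R : Type*} [AddCommMonoid R] (l : Fin n) (f : ℕ → R) :
    ∑ i ∈ Iio l, f i = ∑ i ∈ range l, f i := by
  rw [← Nat.Iio_eq_range, ← Fin.map_valEmbedding_Iio, sum_map]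
  rfl

open Classical in
/-- The filtration function `D` on `(ℤ/p)^n` is determined by its averages over the cosets of
hyperplanes, when these are given by numbers `c a` compatible with the greedy tuple `m`. -/
theorem filtration_of_conductors {p : ℕ} [hp : Fact p.Prime] {n : ℕ}
    (D : (Fin n → ZMod p) → ℕ)
    (hadd : ∀ u v, min (D u) (D v) ≤ D (u + v)) (hneg : ∀ v, D (-v) = D v)
    (hzero : ∀ v, v ≠ 0 → D v < D 0)
    (m : Fin n → ℕ) (c : (Fin n → ZMod p) → ℕ)
    (hc : ∀ i, c (Pi.single i 1) = m i)
    (hmin : ∀ a l j, l ≤ j → a j ≠ 0 → m l ≤ c a)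
    (hsum : ∀ a s, a ⬝ᵥ s ≠ 0 →
      ∑ h with a ⬝ᵥ h = 0, D (s + h) = #{h | a ⬝ᵥ h = 0} * (c a + 1)) :
    ∃ M : Fin n → ℕ, Monotone M ∧ (∀ l v, v l ≠ 0 → (∀ r < l, v r = 0) → D v = M l) ∧
      (∀ l, (M l : ℤ) = (p : ℤ) ^ (l : ℕ) * m l
        - ((p : ℤ) - 1) * ∑ i ∈ Iio l, (p : ℤ) ^ (i : ℕ) * m i + 1) ∧
      ∑ v with v ≠ 0, D v = (p - 1) * ∑ l : Fin n, p ^ (l : ℕ) * (m l + 1) := by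
  have hp1 : 1 < p := hp.out.one_lt
  have hcard : Fintype.card (Fin n → ZMod p) = p ^ n := by simp [ZMod.card]
  have hmono : Monotone m := fun l j h => by
    rw [← hc j]; exact hmin _ l j h (by simp)
  have hmax : ∀ a : Fin n → ZMod p, a ≠ 0 → ∃ s, a ⬝ᵥ s ≠ 0 ∧
      (∀ g, a ⬝ᵥ g ≠ 0 → D g ≤ D s) ∧ herbrandSum D (D s) = p ^ n * (c a + 1) := by
    intro a ha
    obtain ⟨i, hi⟩ := Function.ne_iff.1 ha
    obtain ⟨s, hs, hmax⟩ := exists_max_image ({g | a ⬝ᵥ g ≠ 0} : Finset (Fin n → ZMod p)) D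
      ⟨Pi.single i 1, by simpa using hi⟩
    replace hs := (mem_filter.1 hs).2
    have hmax' : ∀ g, a ⬝ᵥ g ≠ 0 → D g ≤ D s := fun g hg => hmax g (by simpa using hg)
    refine ⟨s, hs, hmax', ?_⟩
    let N : AddSubgroup (Fin n → ZMod p) :=
      { carrier := {h | a ⬝ᵥ h = 0}
        add_mem' := fun {x y} hx hy => by
          simp only [Set.mem_ofPred_eq] at *; rw [dotProduct_add, hx, hy, add_zero]
        zero_mem' := by simp
        neg_mem' := fun {x} hx => by
          simp only [Set.mem_ofPred_eq] at *; rw [dotProduct_neg, hx, neg_zero] }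
    have hN : ∀ h, h ∈ N ↔ a ⬝ᵥ h = 0 := fun h => Iff.rfl
    rw [← hcard]
    refine herbrandSum_of_coset_sums D hadd hneg N _ (fun t ht => ?_) hs hmax'
    simp only [hN]
    exact hsum a t ht
  have hsingle : ∀ l : Fin n, (Pi.single l 1 : Fin n → ZMod p) ≠ 0 := fun l h => by
    simpa using congrFun h l
  choose s hs hsmax hsΦ using fun l => hmax (Pi.single l 1) (hsingle l)
  simp only [single_dotProduct, one_mul, hc] at hs hsmax hsΦ
  have hltz : ∀ l, D (s l) < D 0 := fun l => hzero _ fun h => hs l (by simp [h])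
  have hM : ∀ l v, v l ≠ 0 → (∀ r < l, v r = 0) → D v = D (s l) := by
    intro l v hl hv
    refine le_antisymm (hsmax l v hl) (le_of_not_gt fun hlt => ?_)
    -- If D v is not maximal, the deeper elements form a subgroup missing v. A hyperplane a
    -- containing them but not v has all its complement at depth at most D v, so its conductor is
    -- too small. It involves a coordinate of index at least l, because v vanishes before l; this
    -- contradicts `hmin`.
    let I : AddSubgroup (Fin n → ZMod p) :=
      { carrier := {g | D v < D g}
        add_mem' := fun {x y} hx hy => by
          simp only [Set.mem_ofPred_eq] at *
          exact (lt_min hx hy).trans_le (hadd x y)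
        zero_mem' := hzero v fun h => hl (by simp [h])
        neg_mem' := fun {x} hx => by
          simp only [Set.mem_ofPred_eq] at *; rwa [hneg] }
    have hI : ∀ g, g ∈ I ↔ D v < D g := fun g => Iff.rfl
    obtain ⟨a, hav, haI⟩ := exists_dotProduct_separating I (v := v) (by simp [hI])
    obtain ⟨j, hlj, haj⟩ : ∃ j, l ≤ j ∧ a j ≠ 0 := by
      by_contra! hcon
      refine hav (sum_eq_zero fun i _ => ?_)
      rcases lt_or_ge i l with h | h
      · rw [hv i h, mul_zero]
      · rw [hcon i h, zero_mul]
    obtain ⟨t, hat, -, htΦ⟩ := hmax a fun h => haj (by simp [h])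
    have htv : D t ≤ D v := le_of_not_gt fun h => hat (haI t h)
    have h1 := herbrandSum_lt (htv.trans_lt hlt) 0 (hltz l).le
    rw [htΦ, hsΦ] at h1
    have := hmin a l j hlj haj
    exact absurd h1 (not_lt.2 (Nat.mul_le_mul_left _ (by omega)))
  have hMmono : Monotone fun l => D (s l) := by
    intro l j h
    by_contra! hlt
    have h1 := herbrandSum_lt hlt 0 (hltz l).le
    rw [hsΦ, hsΦ] at h1
    exact absurd h1 (not_lt.2 (Nat.mul_le_mul_left _ (by have := hmono h; omega)))
  have hppos : ∀ e, (p : ℤ) ^ e ≠ 0 := fun e => pow_ne_zero _ (by exact_mod_cast hp.out.ne_zero)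
  -- Extending m by 0 lets the induction run over ℕ; only indices below n enter the sum.
  have hform : ∀ l (h : l < n), (D (s ⟨l, h⟩) : ℤ) = (p : ℤ) ^ l * m ⟨l, h⟩
        - ((p : ℤ) - 1) * ∑ i ∈ range l, (p : ℤ) ^ i * (if h : i < n then m ⟨i, h⟩ else 0 : ℕ)
        + 1 := by
    intro l
    induction l with
    | zero =>
      intro h
      have h1 := hsΦ ⟨0, h⟩
      -- This is the least value of D, so every minimum equals it.
      have h2 : herbrandSum D (D (s ⟨0, h⟩)) = p ^ n * D (s ⟨0, h⟩) := by
        rw [herbrandSum, ← hcard, ← card_univ, ← smul_eq_mul, ← sum_const]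
        refine sum_congr rfl fun v _ => min_eq_left ?_
        by_cases hv : v = 0
        · rw [hv]; exact (hltz _).le
        · obtain ⟨l, hl, hl'⟩ := exists_first_ne_zero hv
          rw [hM l v hl hl']
          exact hMmono (Fin.mk_le_of_le_val (Nat.zero_le _))
      rw [h2] at h1
      have h3 := Nat.eq_of_mul_eq_mul_left (pow_pos hp.out.pos n) h1
      simp [h3]
    | succ l ih =>
      intro h
      have ih' := ih (Nat.lt_of_succ_lt h)
      set u : Fin n := ⟨l, Nat.lt_of_succ_lt h⟩
      set w : Fin n := ⟨l + 1, h⟩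
      have huw : D (s u) ≤ D (s w) := hMmono (by simp [u, w, Fin.le_def])
      -- Between two consecutive values only the vectors whose first l + 1 coordinates vanish still
      -- contribute.
      have hstep : herbrandSum D (D (s w)) =
          herbrandSum D (D (s u)) + p ^ (n - (l + 1)) * (D (s w) - D (s u)) := by
        have hcf := card_filter_vanishing (F := ZMod p) n (l + 1)
        rw [ZMod.card] at hcf
        rw [← hcf, ← smul_eq_mul, ← sum_const, sum_filter, herbrandSum, herbrandSum,
          ← sum_add_distrib]
        refine sum_congr rfl fun v _ => ?_
        by_cases hv : v = 0
        · have := (hltz w).le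
          have := (hltz u).le
          simp only [hv, Pi.zero_apply, implies_true, if_true]
          omega
        · obtain ⟨r, hr, hr'⟩ := exists_first_ne_zero hv
          split_ifs with hvan
          · have : w ≤ r := by
              by_contra! hlt
              exact hr (hvan r hlt)
            have := hMmono this
            simp only at this
            rw [hM r v hr hr']
            omega
          · have : r ≤ u := by
              by_contra! hlt
              refine hvan fun t ht => hr' t ?_
              simp only [Fin.lt_def, u] at hlt ⊢
              omega
            have := hMmono this
            simp only at this
            rw [hM r v hr hr']
            omega
      rw [hsΦ, hsΦ] at hstep
      have hsplit : p ^ n = p ^ (n - (l + 1)) * p ^ (l + 1) := by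
        rw [← pow_add]; congr 1; omega
      have hz : (p : ℤ) ^ (l + 1) * (m w - m u) = D (s w) - D (s u) := by
        refine mul_left_cancel₀ (hppos (n - (l + 1))) ?_
        rw [hsplit] at hstep
        zify [huw] at hstep
        linear_combination hstep
      rw [sum_range_succ, dif_pos (Nat.lt_of_succ_lt h)]
      change _ = _ - _ * (_ + _ * (m u : ℤ)) + 1
      rw [pow_succ] at hz ⊢
      linear_combination ih' - hz
  refine ⟨fun l => D (s l), hMmono, hM, fun l => ?_, ?_⟩
  · rw [hform l l.2]
    congr 2
    rw [← sum_Iio_eq_sum_range l]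
    simp
  · rcases n with _ | n
    · rw [sum_eq_zero fun v hv => absurd (Subsingleton.elim v 0) (mem_filter.1 hv).2]
      simp
    · have h1 := hsΦ (Fin.last n)
      -- The last value bounds D off 0, so truncating there affects only the term at 0.
      have h2 : herbrandSum D (D (s (Fin.last n))) =
          ∑ v with v ≠ 0, D v + D (s (Fin.last n)) := by
        rw [herbrandSum, ← sum_filter_add_sum_filter_not univ (fun v => v ≠ 0)]
        congr 1
        · refine sum_congr rfl fun v hv => min_eq_right ?_
          obtain ⟨l, hl, hl'⟩ := exists_first_ne_zero (mem_filter.1 hv).2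
          rw [hM l v hl hl']
          exact hMmono (Fin.le_last l)
        · simp only [not_not, sum_filter, sum_ite_eq', mem_univ, if_true]
          exact min_eq_left (hltz _).le
      rw [h1] at h2
      have h3 := hform n (Nat.lt_succ_self n)
      rw [← Fin.sum_univ_eq_sum_range
        (fun i => (p : ℤ) ^ i * (if h : i < n + 1 then m ⟨i, h⟩ else 0 : ℕ))] at h3
      have h4 : ∀ i : Fin n, (if h : (i : ℕ) < n + 1 then m ⟨i, h⟩ else 0) = m i.castSucc :=
        fun i => dif_pos (i.2.trans (Nat.lt_succ_self n))
      simp only [h4] at h3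
      have h5 : ((p : ℤ) - 1) * ∑ i : Fin n, (p : ℤ) ^ (i : ℕ) = (p : ℤ) ^ n - 1 := by
        rw [Fin.sum_univ_eq_sum_range (fun i => (p : ℤ) ^ i), mul_geom_sum]
      rw [Fin.sum_univ_castSucc]
      change p ^ (n + 1) * (m ⟨n, Nat.lt_succ_self n⟩ + 1) = _ + D (s ⟨n, Nat.lt_succ_self n⟩) at h2
      change _ = (p - 1) * (_ + p ^ n * (m ⟨n, Nat.lt_succ_self n⟩ + 1))
      zify [hp1.le] at h2 ⊢
      simp only [Fin.val_castSucc, mul_add, mul_one, sum_add_distrib] at h2 h3 h5 ⊢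
      rw [pow_succ] at h2
      linear_combination -h2 - h3 - h5

end Combinatorics

/-! ### Endomorphisms of k[[z]] and substitution. -/

noncomputable section

namespace PowerSeries

variable {k : Type*} [Field k]

theorem eq_zero_of_forall_X_pow_dvd {f : k⟦X⟧} (h : ∀ N, X ^ N ∣ f) : f = 0 := by
  ext n
  exact X_pow_dvd_iff.1 (h (n + 1)) n (Nat.lt_succ_self n)

theorem associated_X_pow_order {f : k⟦X⟧} (hf : f ≠ 0) : Associated (X ^ f.order.toNat) f := by
  have h3 : IsUnit f.divXPowOrder := by
    rw [isUnit_iff_constantCoeff, isUnit_iff_ne_zero, Ne, constantCoeff_divXPowOrder_eq_zero_iff]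
    exact hf
  exact ⟨h3.unit, X_pow_order_mul_divXPowOrder⟩

theorem dvd_iff_order_le {f g : k⟦X⟧} : f ∣ g ↔ f.order ≤ g.order := by
  rcases eq_or_ne f 0 with rfl | hf
  · rw [zero_dvd_iff, order_zero, top_le_iff, order_eq_top]
  · rw [← (associated_X_pow_order hf).dvd_iff_dvd_left, X_pow_dvd_iff, ← coe_toNat_order hf]
    exact ⟨fun h => nat_le_order _ _ h, fun h i hi => coeff_of_lt_order _ ((Nat.cast_lt.2 hi).trans_le h)⟩


/-- If a = φ(X)(0) were nonzero, X - a would be a unit with the non-unit image φ(X) - a. Thus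
algebra endomorphisms are automatically local. -/
theorem constantCoeff_algHom_X (φ : k⟦X⟧ →ₐ[k] k⟦X⟧) : constantCoeff (φ X) = 0 := by
  by_contra h
  have hu : IsUnit (X - C (constantCoeff (φ X)) : k⟦X⟧) := by
    rw [isUnit_iff_constantCoeff]
    simpa using h
  have h2 := hu.map φ
  have hC : φ (C (constantCoeff (φ X))) = C (constantCoeff (φ X)) := φ.commutes _
  rw [isUnit_iff_constantCoeff, map_sub, hC] at h2
  simp at h2

theorem algHom_coe_polynomial (φ : k⟦X⟧ →ₐ[k] k⟦X⟧) (q : Polynomial k) :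
    φ q = Polynomial.aeval (φ X) q := by
  have : φ.comp (Polynomial.coeToPowerSeries.algHom k) = Polynomial.aeval (φ X) := by
    ext
    simp
  have h2 := DFunLike.congr_fun this q
  simpa using h2

theorem X_dvd_algHom_X (φ : k⟦X⟧ →ₐ[k] k⟦X⟧) : X ∣ φ X :=
  X_dvd_iff.2 (constantCoeff_algHom_X φ)

/-- Truncation reduces to polynomials, where x - y divides q(x) - q(y); locality makes the tail
divisible by X ^ N. No continuity is assumed. -/
theorem X_pow_dvd_algHom_sub {φ ψ : k⟦X⟧ →ₐ[k] k⟦X⟧} (δ : k⟦X⟧) (h : δ ∣ φ X - ψ X) (P : k⟦X⟧)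
    (N : ℕ) : ∃ r, δ ∣ r ∧ X ^ N ∣ φ P - ψ P - r := by
  refine ⟨φ (trunc N P) - ψ (trunc N P), ?_, ?_⟩
  · rw [algHom_coe_polynomial, algHom_coe_polynomial, Polynomial.aeval_def, Polynomial.aeval_def,
      Polynomial.eval₂_eq_eval_map, Polynomial.eval₂_eq_eval_map]
    exact h.trans (Polynomial.sub_dvd_eval_sub _ _ _)
  · have e := eq_X_pow_mul_shift_add_trunc N P
    set Q : k⟦X⟧ := mk fun i => P.coeff (i + N)
    have : φ P - ψ P - (φ (trunc N P) - ψ (trunc N P)) = φ X ^ N * φ Q - ψ X ^ N * ψ Q := by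
      have e1 := congrArg φ e
      have e2 := congrArg ψ e
      simp only [map_add, map_mul, map_pow] at e1 e2
      linear_combination e1 - e2
    rw [this]
    exact dvd_sub ((pow_dvd_pow_of_dvd (X_dvd_algHom_X φ) N).mul_right _)
      ((pow_dvd_pow_of_dvd (X_dvd_algHom_X ψ) N).mul_right _)

theorem algHom_ext_X {φ ψ : k⟦X⟧ →ₐ[k] k⟦X⟧} (h : φ X = ψ X) : φ = ψ := by
  refine AlgHom.ext fun P => sub_eq_zero.1 (eq_zero_of_forall_X_pow_dvd fun N => ?_)
  obtain ⟨r, hr, hN⟩ := X_pow_dvd_algHom_sub (φ := φ) (ψ := ψ) 0 (by simp [h]) P N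
  rwa [zero_dvd_iff.1 hr, sub_zero] at hN

/-- Two endomorphisms of `k[[z]]` are congruent modulo the difference of their values at `z`. -/
theorem algHom_sub_dvd (φ ψ : k⟦X⟧ →ₐ[k] k⟦X⟧) (P : k⟦X⟧) : φ X - ψ X ∣ φ P - ψ P := by
  rcases eq_or_ne (φ X - ψ X) 0 with h | h
  · rw [algHom_ext_X (sub_eq_zero.1 h)]; simp
  · obtain ⟨r, hr, hN⟩ := X_pow_dvd_algHom_sub (φ := φ) (ψ := ψ) _ dvd_rfl P
      (φ X - ψ X).order.toNat
    have := dvd_add ((associated_X_pow_order h).dvd'.trans hN) hr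
    simpa using this

variable (t : k⟦X⟧) (ht : constantCoeff t = 0)

/-- Substitution of `t` as an endomorphism of `k[[z]]`. -/
def evalHom : k⟦X⟧ →ₐ[k] k⟦X⟧ := substAlgHom (HasSubst.of_constantCoeff_zero' ht)

@[simp] theorem evalHom_X : evalHom t ht X = t := substAlgHom_X _

theorem order_evalHom (P : k⟦X⟧) (hP : P ≠ 0) :
    (evalHom t ht P).order = P.order.toNat • t.order := by
  obtain ⟨u, hu⟩ := associated_X_pow_order hP
  conv_lhs => rw [← hu]
  rw [map_mul, order_mul, order_zero_of_unit (u.isUnit.map _), add_zero, map_pow, evalHom_X,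
    order_pow]

theorem evalHom_injective (h0 : t ≠ 0) : Function.Injective (evalHom t ht) := by
  rw [injective_iff_map_eq_zero]
  intro P hP
  by_contra hne
  have := order_evalHom t ht P hne
  rw [hP, order_zero, ← coe_toNat_order h0] at this
  simp only [nsmul_eq_mul] at this
  exact absurd this.symm (by exact_mod_cast ENat.natCast_ne_top _)

/-- `k[[z]]` is generated by `1, z, …, z ^ (e - 1)` over `k[[t]]`, for `t` of order `e`. -/
theorem exists_eq_sum_evalHom {e : ℕ} (he : t.order = e) (x : k⟦X⟧) :
    ∃ P : ℕ → k⟦X⟧, x = ∑ i ∈ Finset.range e, evalHom t ht (P i) * X ^ i := by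
  have h0 : t ≠ 0 := by rintro rfl; simp at he
  obtain ⟨v, hv⟩ : ∃ v, X ^ e = t * v := by
    have := (associated_X_pow_order h0).dvd'
    rwa [he, ENat.toNat_natCast] at this
  -- The quotient in division by t with remainder of degree less than e. Iterating it yields the
  -- t-adic digits, collected below in the series P.
  let next : k⟦X⟧ → k⟦X⟧ := fun y => v * mk fun i => y.coeff (i + e)
  have hnext : ∀ y, y = ∑ i ∈ Finset.range e, C (y.coeff i) * X ^ i + t * next y := fun y => by
    have h1 := eq_X_pow_mul_shift_add_trunc e y
    have h2 : ((trunc e y : Polynomial k) : k⟦X⟧) = ∑ i ∈ Finset.range e, C (y.coeff i) * X ^ i := by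
      rw [← Polynomial.eval₂_C_X_eq_coe, eval₂_trunc_eq_sum_range]
    rw [h2, hv] at h1
    conv_lhs => rw [h1]
    simp only [next]
    ring
  let P : ℕ → ℕ → k⟦X⟧ := fun N i => mk fun j => (next^[j + N] x).coeff i
  have hP : ∀ N i, evalHom t ht (P N i) =
      C ((next^[N] x).coeff i) + t * evalHom t ht (P (N + 1) i) := fun N i => by
    have : P N i = C ((next^[N] x).coeff i) + X * P (N + 1) i := by
      ext j
      rcases j with _ | j
      · simp [P]
      · simp only [P, coeff_mk, map_add, coeff_succ_X_mul, coeff_succ_C, zero_add]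
        rw [add_right_comm, add_assoc]
    conv_lhs => rw [this]
    rw [map_add, map_mul, evalHom_X]
    congr 1
    exact (evalHom t ht).commutes _
  -- The error of the expansion is divisible by every power of t, hence zero.
  have key : ∀ N, next^[0] x - ∑ i ∈ Finset.range e, evalHom t ht (P 0 i) * X ^ i =
      t ^ N * (next^[N] x - ∑ i ∈ Finset.range e, evalHom t ht (P N i) * X ^ i) := by
    intro N
    induction N with
    | zero => simp
    | succ N ih =>
      rw [ih, pow_succ, mul_assoc]
      congr 1
      conv_lhs => rw [hnext (next^[N] x)]
      simp only [hP N, ← Function.iterate_succ_apply' next, add_mul, Finset.sum_add_distrib,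
        mul_sub, Finset.mul_sum, mul_assoc]
      ring
  refine ⟨P 0, sub_eq_zero.1 (eq_zero_of_forall_X_pow_dvd fun N => ?_)⟩
  have := key N
  rw [Function.iterate_zero_apply] at this
  rw [this]
  exact (pow_dvd_pow_of_dvd (X_dvd_iff.2 ht) N).mul_right _

end PowerSeries

end

/-! ### Finite groups acting on k[[z]] and their invariants. -/

noncomputable section

namespace PowerSeries

variable {k : Type*} [Field k] {Γ : Type*} [Group Γ] [MulSemiringAction Γ k⟦X⟧]
  [SMulCommClass Γ k k⟦X⟧]

/-- The automorphism `σ` of `k[[z]]` as an algebra homomorphism. -/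
abbrev actionHom (σ : Γ) : k⟦X⟧ →ₐ[k] k⟦X⟧ := MulSemiringAction.toAlgHom k k⟦X⟧ σ

theorem X_dvd_smul_X (σ : Γ) : (X : k⟦X⟧) ∣ σ • X := X_dvd_algHom_X (actionHom σ)

theorem order_smul (σ : Γ) (x : k⟦X⟧) : (σ • x).order = x.order := by
  have key : ∀ (σ : Γ) (x : k⟦X⟧), x.order ≤ (σ • x).order := fun σ x => by
    rcases eq_or_ne x 0 with rfl | hx
    · simp
    · rw [← dvd_iff_order_le]
      have h1 := (associated_X_pow_order hx).dvd'
      have h2 : σ • X ^ x.order.toNat ∣ σ • x := map_dvd (actionHom σ) (associated_X_pow_order hx).dvd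
      rw [smul_pow'] at h2
      exact h1.trans ((pow_dvd_pow_of_dvd (X_dvd_smul_X σ) _).trans h2)
  refine le_antisymm ?_ (key σ x)
  have := key σ⁻¹ (σ • x)
  rwa [inv_smul_smul] at this

theorem smul_sub_self_dvd (σ : Γ) (x : k⟦X⟧) : σ • X - X ∣ σ • x - x :=
  algHom_sub_dvd (actionHom σ) (AlgHom.id k _) x

theorem smul_X_injective [FaithfulSMul Γ k⟦X⟧] :
    Function.Injective fun σ : Γ => σ • (X : k⟦X⟧) := by
  intro σ τ h
  have : actionHom (k := k) σ = actionHom τ := algHom_ext_X h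
  exact FaithfulSMul.eq_of_smul_eq_smul (α := k⟦X⟧) fun x => DFunLike.congr_fun this x

variable (k Γ) in
/-- The norm of `z`. -/
def normX [Fintype Γ] : k⟦X⟧ := ∏ σ : Γ, σ • X

variable [Fintype Γ]

theorem smul_normX {k Γ : Type*} [Field k] [Group Γ] [Fintype Γ] [MulSemiringAction Γ k⟦X⟧]
    (σ : Γ) : σ • normX k Γ = normX k Γ := by
  rw [normX, Finset.smul_prod']
  exact Fintype.prod_equiv (Equiv.mulLeft σ) _ _ fun τ => by simp [mul_smul]

theorem order_normX : (normX k Γ).order = Fintype.card Γ := by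
  rw [normX, order_prod]
  simp [order_smul]

theorem constantCoeff_normX : constantCoeff (normX k Γ) = 0 := by
  rw [← order_ne_zero_iff_constCoeff_eq_zero, order_normX]
  exact_mod_cast Fintype.card_ne_zero

theorem normX_ne_zero : normX k Γ ≠ 0 := by
  intro h
  have := order_normX (k := k) (Γ := Γ)
  rw [h, order_zero] at this
  exact absurd this.symm (ENat.natCast_ne_top _)

variable (k Γ) in
/-- The embedding of `k[[z]]` into itself as the ring of invariants of `Γ`. -/
abbrev normHom : k⟦X⟧ →ₐ[k] k⟦X⟧ := evalHom (normX k Γ) constantCoeff_normX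

theorem smul_normHom (σ : Γ) (P : k⟦X⟧) : σ • normHom k Γ P = normHom k Γ P := by
  have : (actionHom σ).comp (normHom k Γ) = normHom k Γ := algHom_ext_X (by simp [smul_normX])
  exact DFunLike.congr_fun this P

theorem order_normHom {P : k⟦X⟧} (hP : P ≠ 0) :
    (normHom k Γ P).order = (P.order.toNat * Fintype.card Γ : ℕ) := by
  rw [order_evalHom _ _ _ hP, order_normX]
  simp

theorem normHom_injective : Function.Injective (normHom k Γ) := evalHom_injective _ _ normX_ne_zero

theorem exists_eq_sum_normHom (x : k⟦X⟧) : ∃ P : ℕ → k⟦X⟧,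
    x = ∑ i ∈ Finset.range (Fintype.card Γ), normHom k Γ (P i) * X ^ i :=
  exists_eq_sum_evalHom _ constantCoeff_normX order_normX x

/-- Expand y in powers of X of exponent below |Γ| with coefficients in k[[normX]]. As y and the
coefficients are invariant, the resulting polynomial equation holds at all |Γ| conjugates of X,
exceeding its degree. It is therefore trivial, and y is its constant coefficient. -/
theorem exists_normHom_eq [FaithfulSMul Γ k⟦X⟧] {y : k⟦X⟧} (hy : ∀ σ : Γ, σ • y = y) :
    ∃ P, normHom k Γ P = y := by
  obtain ⟨P, hP⟩ := exists_eq_sum_normHom (Γ := Γ) y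
  set q : Polynomial k⟦X⟧ := ∑ i ∈ Finset.range (Fintype.card Γ),
    Polynomial.C (normHom k Γ (P i)) * Polynomial.X ^ i - Polynomial.C y with hq
  have hdeg : q.natDegree < Fintype.card Γ := by
    refine (Polynomial.natDegree_sub_le _ _).trans_lt (max_lt ?_ (by simp [Fintype.card_pos]))
    refine (Polynomial.natDegree_sum_le_of_forall_le (n := Fintype.card Γ - 1) _ _
      fun i hi => ?_).trans_lt (Nat.sub_lt Fintype.card_pos one_pos)
    exact (Polynomial.natDegree_C_mul_X_pow_le _ _).trans (Nat.le_sub_one_of_lt (Finset.mem_range.1 hi))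
  have hroot : ∀ σ : Γ, q.eval (σ • X) = 0 := fun σ => by
    have h1 := congrArg (fun x => σ • x) hP
    simp only [Finset.smul_sum, smul_mul', smul_normHom, smul_pow', hy σ] at h1
    simp only [hq, Polynomial.eval_sub, Polynomial.eval_finsetSum, Polynomial.eval_mul,
      Polynomial.eval_C, Polynomial.eval_pow, Polynomial.eval_X]
    rw [← h1, sub_self]
  have hq0 := Polynomial.eq_zero_of_natDegree_lt_card_of_eval_eq_zero q
    (smul_X_injective (k := k) (Γ := Γ)) hroot hdeg
  refine ⟨P 0, ?_⟩
  have h0 := congrArg (fun q => q.eval 0) hq0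
  simp only [hq, Polynomial.eval_sub, Polynomial.eval_finsetSum, Polynomial.eval_mul,
      Polynomial.eval_C, Polynomial.eval_pow, Polynomial.eval_X, Polynomial.eval_zero] at h0
  rw [Finset.sum_eq_single_of_mem 0 (Finset.mem_range.2 Fintype.card_pos)] at h0
  · simpa [sub_eq_zero] using h0
  · intro i _ hi
    simp [hi]

/-- Every element of `k[[z]]` is a polynomial in `z` with invariant coefficients. -/
theorem exists_polynomial_invariant (x : k⟦X⟧) : ∃ q : Polynomial k⟦X⟧,
    (∀ (σ : Γ) i, σ • q.coeff i = q.coeff i) ∧ q.eval X = x := by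
  obtain ⟨P, hP⟩ := exists_eq_sum_normHom (Γ := Γ) x
  refine ⟨∑ i ∈ Finset.range (Fintype.card Γ),
    Polynomial.C (normHom k Γ (P i)) * Polynomial.X ^ i, fun σ i => ?_, ?_⟩
  · simp only [Polynomial.finsetSum_coeff, Polynomial.coeff_C_mul_X_pow, Finset.smul_sum, smul_ite,
      smul_normHom, smul_zero]
  · rw [hP]
    simp [Polynomial.eval_finsetSum]

end PowerSeries

end

/-! ### Orders of σ(x) - x and passage to a quotient group. -/

noncomputable section

namespace PowerSeries

variable {k : Type*} [Field k]

theorem coeff_one_algHom (φ : k⟦X⟧ →ₐ[k] k⟦X⟧) (P : k⟦X⟧) :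
    coeff 1 (φ P) = coeff 1 (φ X) * coeff 1 P := by
  have e := eq_X_pow_mul_shift_add_trunc 2 P
  set Q : k⟦X⟧ := mk fun i => P.coeff (i + 2)
  obtain ⟨v, hv⟩ := X_dvd_algHom_X φ
  have h1 : φ P = X ^ 2 * (v ^ 2 * φ Q) + C (coeff 0 P) + φ X * C (coeff 1 P) := by
    have h2 := congrArg φ e
    rw [map_add, map_mul, map_pow, algHom_coe_polynomial φ (trunc 2 P), Polynomial.aeval_def,
      eval₂_trunc_eq_sum_range, Finset.sum_range_succ, Finset.sum_range_one] at h2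
    simp only [algebraMap_apply, Algebra.algebraMap_self, RingHom.id_apply] at h2
    rw [h2]
    have h3 : φ X ^ 2 = X ^ 2 * v ^ 2 := by rw [hv]; ring
    rw [h3]
    ring
  rw [h1]
  simp [coeff_X_pow_mul', coeff_mul_C]

/-- An endomorphism of `k[[z]]` moves `P` as much as it moves `z ^ c`, where `c` is the order of `P`
and is not divisible by the characteristic. -/
theorem associated_algHom_sub {φ ψ : k⟦X⟧ →ₐ[k] k⟦X⟧} {ε P : k⟦X⟧}
    (hε : φ X - ψ X = ψ X * ε) (hε0 : constantCoeff ε = 0) {c : ℕ} (hP : P.order = c)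
    (hc : (c : k) ≠ 0) : Associated (φ P - ψ P) (ψ X ^ c * ε) := by
  have hP0 : P ≠ 0 := by rintro rfl; simp at hP
  obtain ⟨u, hu⟩ := associated_X_pow_order hP0
  rw [hP, ENat.toNat_natCast] at hu
  obtain ⟨r, hr⟩ := algHom_sub_dvd φ ψ (u : k⟦X⟧)
  -- With P = X ^ c * u and φ X = ψ X * (1 + ε), the first-order term c ε dominates, provided c is
  -- nonzero in k.
  obtain ⟨q, hq⟩ : ∃ q, (1 + ε) ^ c = 1 + c * ε + ε ^ 2 * q := by
    obtain ⟨q, hq⟩ := Polynomial.binomExpansion (Polynomial.X ^ c) 1 ε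
    refine ⟨q, ?_⟩
    simp only [Polynomial.eval_pow, Polynomial.eval_X, one_pow, Polynomial.derivative_X_pow,
      Polynomial.eval_mul, mul_one, map_natCast, Polynomial.eval_natCast] at hq
    rw [hq]; ring
  have hφX : φ X = ψ X * (1 + ε) := by linear_combination hε
  have key : φ P - ψ P = ψ X ^ c * ε * ((c + ε * q) * φ u + ψ X * r) := by
    rw [← hu, map_mul, map_mul, map_pow, map_pow, hφX, mul_pow, hq]
    rw [hε] at hr
    linear_combination (ψ X) ^ c * hr
  have hunit : IsUnit ((c + ε * q) * φ u + ψ X * r) := by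
    rw [isUnit_iff_constantCoeff, isUnit_iff_ne_zero]
    have h1 : constantCoeff (φ u) ≠ 0 := by
      have := u.isUnit.map φ
      rwa [isUnit_iff_constantCoeff, isUnit_iff_ne_zero] at this
    simp [hε0, constantCoeff_algHom_X, hc, h1]
  rw [key]
  exact associated_mul_unit_left _ _ hunit

theorem prod_X_sub_C_dvd_of_injective {R ι : Type*} [CommRing R] [IsDomain R] [Fintype ι]
    {f : ι → R} (hf : Function.Injective f) {q : Polynomial R} (hq : ∀ i, q.IsRoot (f i)) :
    ∏ i, (Polynomial.X - Polynomial.C (f i)) ∣ q := by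
  rcases eq_or_ne q 0 with rfl | hq0
  · exact dvd_zero _
  · have h1 : ∏ i, (Polynomial.X - Polynomial.C (f i)) =
        ((Finset.univ.val.map f).map fun a => Polynomial.X - Polynomial.C a).prod := by
      rw [Multiset.map_map]; rfl
    rw [h1, Multiset.prod_X_sub_C_dvd_iff_le_roots hq0,
      Multiset.le_iff_subset (Finset.univ.nodup.map hf)]
    intro a ha
    obtain ⟨i, -, rfl⟩ := Multiset.mem_map.1 ha
    exact (Polynomial.mem_roots hq0).2 (hq i)

variable {Γ : Type*} [Group Γ] [MulSemiringAction Γ k⟦X⟧] [SMulCommClass Γ k k⟦X⟧]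

/-- The linear coefficient is multiplicative along powers of σ, so here it is a p-th root of unity,
and 1 is the only one in characteristic p. -/
theorem X_sq_dvd_smul_X_sub_X {p : ℕ} [hp : Fact p.Prime] [CharP k p] {σ : Γ} (hσ : σ ^ p = 1) :
    (X : k⟦X⟧) ^ 2 ∣ σ • X - X := by
  have h1 : ∀ N : ℕ, coeff 1 (σ ^ N • (X : k⟦X⟧)) = coeff 1 (σ • (X : k⟦X⟧)) ^ N := by
    intro N
    induction N with
    | zero => simp
    | succ N ih =>
      rw [pow_succ', mul_smul, pow_succ', ← ih]
      exact coeff_one_algHom (actionHom σ) _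
  have h2 : coeff 1 (σ • (X : k⟦X⟧)) = 1 := by
    have h3 := h1 p
    rw [hσ, one_smul, coeff_one_X] at h3
    have h4 : (coeff 1 (σ • (X : k⟦X⟧)) - 1) ^ p = 0 := by
      rw [sub_pow_char, ← h3]; simp
    exact sub_eq_zero.1 (pow_eq_zero_iff hp.out.ne_zero |>.1 h4)
  rw [X_pow_dvd_iff]
  intro m hm
  interval_cases m
  · have := X_dvd_iff.1 (X_dvd_smul_X (k := k) σ)
    simpa using this
  · simp [h2]

/-- The order of `s(t) - t` for `t` a uniformizer of `k[[z]]^N`, in terms of the coset `sN`. -/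
theorem associated_prod_smul_sub [Fintype Γ] [FaithfulSMul Γ k⟦X⟧] (N : Subgroup Γ) [Fintype N]
    (s : Γ) :
    Associated (∏ h : N, (s • (h : Γ) • (X : k⟦X⟧) - X)) (s • normX k N - normX k N) := by
  classical
  refine associated_of_dvd_dvd ?_ ?_
  -- Since Q has Γ-invariant coefficients and takes the value normX at X, it takes the value s •
  -- normX at each conjugate s h X. Factor out these roots and evaluate at X.
  · obtain ⟨Q, hQ, hQX⟩ := exists_polynomial_invariant (Γ := Γ) (normX k N)
    have hdvd : ∏ h : N, (Polynomial.X - Polynomial.C (s • (h : Γ) • (X : k⟦X⟧))) ∣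
        Q - Polynomial.C (s • normX k N) := by
      refine prod_X_sub_C_dvd_of_injective (fun h h' heq => ?_) fun h => ?_
      · exact Subtype.ext (smul_X_injective (k := k) (MulAction.injective s heq))
      · rw [Polynomial.IsRoot, Polynomial.eval_sub, Polynomial.eval_C,
          sub_eq_zero, ← mul_smul]
        have : Q.eval ((s * h) • X) = (s * h) • Q.eval X := by
          rw [Polynomial.eval_eq_sum_range, Polynomial.eval_eq_sum_range, Finset.smul_sum]
          simp only [smul_mul', hQ, smul_pow']
        rw [this, hQX, mul_smul]
        congr 1
        exact smul_normX (k := k) h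
    have := Polynomial.eval_dvd (x := X) hdvd
    rw [Polynomial.eval_prod] at this
    simp only [Polynomial.eval_sub, Polynomial.eval_X, Polynomial.eval_C, hQX] at this
    rw [← neg_sub (normX k N), dvd_neg]
    refine dvd_trans ?_ this
    refine Finset.prod_dvd_prod_of_dvd _ _ fun h _ => ?_
    rw [← neg_sub X, neg_dvd]
  -- The coefficients of g are series in normX, so s moves each by a multiple of s • normX - normX.
  -- Evaluate s g - g at X, a root of g.
  · set g : Polynomial k⟦X⟧ := ∏ h : N, (Polynomial.X - Polynomial.C (h • (X : k⟦X⟧))) with hg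
    have hinv : ∀ h : N, g.map (MulSemiringAction.toRingHom N k⟦X⟧ h) = g := fun h => by
      rw [hg, Polynomial.map_prod]
      refine Fintype.prod_equiv (Equiv.mulLeft h) _ _ fun h' => ?_
      simp [mul_smul]
    have hcoeff : ∀ i (h : N), h • g.coeff i = g.coeff i := fun i h => by
      conv_rhs => rw [← hinv h]
      rw [Polynomial.coeff_map]
      rfl
    have hdvd : Polynomial.C (s • normX k N - normX k N) ∣
        g.map (MulSemiringAction.toRingHom Γ k⟦X⟧ s) - g := by
      rw [Polynomial.C_dvd_iff_dvd_coeff]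
      intro i
      obtain ⟨P, hP⟩ := exists_normHom_eq (hcoeff i)
      have := algHom_sub_dvd ((actionHom s).comp (normHom k N)) (normHom k N) P
      simpa [hP] using this
    have h1 := Polynomial.eval_dvd (x := X) hdvd
    have h2 : g.eval X = 0 := by
      rw [hg, Polynomial.eval_prod]
      exact Finset.prod_eq_zero (Finset.mem_univ 1) (by simp)
    rw [Polynomial.eval_sub, h2, sub_zero, Polynomial.eval_C, hg, Polynomial.map_prod,
      Polynomial.eval_prod] at h1
    refine h1.trans (Finset.prod_dvd_prod_of_dvd _ _ fun h _ => ?_)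
    simp only [Polynomial.map_sub, Polynomial.map_X, Polynomial.map_C, Polynomial.eval_sub,
      Polynomial.eval_X, Polynomial.eval_C]
    rw [← neg_sub, neg_dvd]
    rfl

/-- With t the norm of X over N and s t = t(1 + ε), a series x of order c in t is moved by t ^ c * ε
up to a unit. Comparing orders gives ord ε = c|N|, so s t - t has order |N|(c + 1). The intended x
is the inverse of an Artin–Schreier generator. -/
theorem sum_order_smul_sub_of_invariant [Fintype Γ] [FaithfulSMul Γ k⟦X⟧] (N : Subgroup Γ)
    [Fintype N] (h2 : ∀ σ : Γ, (X : k⟦X⟧) ^ 2 ∣ σ • X - X) (s : Γ) {x : k⟦X⟧}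
    (hx : ∀ h : N, h • x = x) {c : ℕ} (hc : (c : k) ≠ 0)
    (hxo : x.order = (c * Fintype.card N : ℕ))
    (hs : (s • x - x).order = (2 * (c * Fintype.card N) : ℕ)) :
    ∑ h : N, (s • (h : Γ) • (X : k⟦X⟧) - X).order = ((Fintype.card N * (c + 1) : ℕ) : ℕ∞) := by
  obtain ⟨P, rfl⟩ := exists_normHom_eq hx
  have hcard : 0 < Fintype.card N := Fintype.card_pos
  have hP0 : P ≠ 0 := by
    rintro rfl
    rw [map_zero, order_zero] at hxo
    exact ENat.natCast_ne_top _ hxo.symm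
  have hPo : P.order = c := by
    rw [order_normHom hP0, Nat.cast_inj] at hxo
    rw [← coe_toNat_order hP0, Nat.eq_of_mul_eq_mul_right hcard hxo]
  have hser := associated_prod_smul_sub (k := k) N s
  have hord : ∑ h : N, (s • (h : Γ) • (X : k⟦X⟧) - X).order =
      (s • normX k N - normX k N).order := by
    rw [← order_prod]
    exact le_antisymm (dvd_iff_order_le.1 hser.dvd) (dvd_iff_order_le.1 hser.dvd')
  -- Wildness of the action ensures that ε below lies in the maximal ideal.
  have hge : (2 * Fintype.card N : ℕ) ≤ (s • normX k N - normX k N).order := by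
    rw [← hord]
    have : ∀ h : N, (2 : ℕ∞) ≤ (s • (h : Γ) • (X : k⟦X⟧) - X).order := fun h => by
      rw [← mul_smul]
      have := dvd_iff_order_le.1 (h2 (s * h))
      rwa [order_X_pow] at this
    calc ((2 * Fintype.card N : ℕ) : ℕ∞) = ∑ h : N, (2 : ℕ∞) := by
          simp [mul_comm]
      _ ≤ _ := Finset.sum_le_sum fun h _ => this h
  have hzo := order_normX (k := k) (Γ := N)
  obtain ⟨ε, hε⟩ : normX k N ∣ s • normX k N - normX k N := by
    rw [dvd_iff_order_le, hzo]
    refine le_trans ?_ hge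
    exact_mod_cast (by omega)
  have hε1 : (s • normX k N - normX k N).order = Fintype.card N + ε.order := by
    rw [hε, order_mul, hzo]
  have hε0 : constantCoeff ε = 0 := by
    rw [← order_ne_zero_iff_constCoeff_eq_zero]
    intro h0
    rw [hε1, h0, add_zero, Nat.cast_le] at hge
    omega
  have hass := associated_algHom_sub (φ := (actionHom s).comp (normHom k N)) (ψ := normHom k N)
    (ε := ε) (P := P) (by simpa using hε) hε0 hPo hc
  have ho : (s • normHom k N P - normHom k N P).order = (normX k N ^ c * ε).order := by
    have h3 := dvd_iff_order_le.1 hass.dvd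
    have h4 := dvd_iff_order_le.1 hass.dvd'
    rw [evalHom_X] at h3 h4
    exact le_antisymm h3 h4
  have hεfin : ε ≠ 0 := by
    rintro rfl
    rw [hs, mul_zero, order_zero] at ho
    exact ENat.natCast_ne_top _ ho
  rw [hs, order_mul, order_pow, hzo, ← coe_toNat_order hεfin] at ho
  rw [hord, hε1, ← coe_toNat_order hεfin]
  simp only [nsmul_eq_mul] at ho
  norm_cast at ho ⊢
  nlinarith

end PowerSeries

end

/-! ### The different of k[[z]] over its invariants. -/

noncomputable section

section Monogenic

open Polynomial

attribute [local instance] FractionRing.liftAlgebra in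
theorem adjoin_fractionRing_eq_top {A B Γ : Type*} [CommRing A] [IsDomain A] [CommRing B]
    [IsDomain B] [Algebra A B] [FaithfulSMul A B] [Group Γ] [Finite Γ] [MulSemiringAction Γ B]
    [IsGaloisGroup Γ A B] {x : B} (hx : Function.Injective fun σ : Γ => σ • x) :
    Algebra.adjoin (FractionRing A) {algebraMap B (FractionRing B) x} = ⊤ := by
  let := IsFractionRing.mulSemiringAction Γ B (FractionRing B)
  have hgal := IsGaloisGroup.to_isFractionRing Γ A B (FractionRing A) (FractionRing B)
  have hfin := IsGaloisGroup.finiteDimensional Γ (FractionRing A) (FractionRing B)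
  set y := algebraMap B (FractionRing B) x
  rw [← IntermediateField.adjoin_simple_toSubalgebra_of_isAlgebraic
    (Algebra.IsAlgebraic.isAlgebraic y), ← IntermediateField.top_toSubalgebra]
  congr 1
  have h1 : fixingSubgroup Γ
      (IntermediateField.adjoin (FractionRing A) {y} : Set (FractionRing B)) = ⊥ := by
    rw [eq_bot_iff]
    intro σ hσ
    have h2 : σ • y = y := hσ ⟨y, IntermediateField.mem_adjoin_simple_self _ y⟩
    rw [← algebraMap.smul'] at h2
    exact hx (by simpa using IsFractionRing.injective B (FractionRing B) h2)
  rw [← IsGaloisGroup.fixedPoints_fixingSubgroup Γ (FractionRing A) (FractionRing B)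
    (IntermediateField.adjoin (FractionRing A) {y}), h1, IsGaloisGroup.fixedPoints_bot]

-- Euler's formula: the different of A[x] is generated by f'(x), for f the minimal polynomial of x.
-- Here f = ∏ (X - σx), and only the factor σ = 1 vanishes at x.
attribute [local instance] FractionRing.liftAlgebra in
open Classical in
theorem differentIdeal_eq_span_prod {A B Γ : Type*} [CommRing A] [IsDomain A]
    [IsIntegrallyClosed A] [CommRing B] [IsDedekindDomain B] [Algebra A B] [FaithfulSMul A B]
    [Group Γ] [Fintype Γ] [MulSemiringAction Γ B] [IsGaloisGroup Γ A B] {x : B}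
    (hx : Function.Injective fun σ : Γ => σ • x) (hxA : Algebra.adjoin A {x} = ⊤) :
    differentIdeal A B = Ideal.span {∏ σ : Γ with σ ≠ 1, (x - σ • x)} := by
  have hint : Algebra.IsIntegral A B := Algebra.IsInvariant.isIntegral A B Γ
  let := IsFractionRing.mulSemiringAction Γ B (FractionRing B)
  have hgal := IsGaloisGroup.to_isFractionRing Γ A B (FractionRing A) (FractionRing B)
  have hfin := IsGaloisGroup.finiteDimensional Γ (FractionRing A) (FractionRing B)
  have hgal' := IsGaloisGroup.isGalois Γ (FractionRing A) (FractionRing B)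
  have hcl : IsIntegralClosure B A (FractionRing B) := inferInstance
  have h := conductor_mul_differentIdeal A (FractionRing A) (FractionRing B) x
    (adjoin_fractionRing_eq_top hx)
  rw [conductor_eq_top_of_adjoin_eq_top hxA, Ideal.top_mul] at h
  rw [h]
  have hxi : IsIntegral A x := hint.isIntegral x
  have hdvd : ∏ σ : Γ, (X - C (σ • x)) ∣ (minpoly A x).map (algebraMap A B) := by
    refine PowerSeries.prod_X_sub_C_dvd_of_injective hx fun σ => ?_
    have h1 : aeval (σ • x) (minpoly A x) = σ • aeval x (minpoly A x) :=
      Polynomial.aeval_algHom_apply (MulSemiringAction.toAlgHom A B σ) x (minpoly A x)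
    rw [IsRoot, eval_map_algebraMap, h1, minpoly.aeval, smul_zero]
  obtain ⟨q, hq⟩ := (mem_lifts _).1 (Algebra.IsInvariant.charpoly_mem_lifts A B Γ x)
  have hdvd' : (minpoly A x).map (algebraMap A B) ∣ ∏ σ : Γ, (X - C (σ • x)) := by
    rw [← MulSemiringAction.charpoly_eq, ← hq]
    refine Polynomial.map_dvd _ (minpoly.isIntegrallyClosed_dvd hxi ?_)
    rw [← eval_map_algebraMap, hq, MulSemiringAction.eval_charpoly]
  have hmin : (minpoly A x).map (algebraMap A B) = ∏ σ : Γ, (X - C (σ • x)) :=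
    eq_of_monic_of_associated ((minpoly.monic hxi).map _)
      (monic_prod_of_monic _ _ fun σ _ => monic_X_sub_C _) (associated_of_dvd_dvd hdvd' hdvd)
  rw [← eval_map_algebraMap, ← derivative_map, hmin, derivative_prod_finset, eval_finsetSum,
    Finset.sum_eq_single_of_mem (1 : Γ) (Finset.mem_univ _)]
  · simp [eval_prod, Finset.filter_ne']
  · intro σ _ hσ
    rw [eval_mul, eval_prod, Finset.prod_eq_zero (i := (1 : Γ)) (by simpa using hσ.symm) (by simp),
      zero_mul]

end Monogenic

namespace PowerSeries

variable {k : Type*} [Field k] {Γ : Type*} [Group Γ] [MulSemiringAction Γ k⟦X⟧]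
  [SMulCommClass Γ k k⟦X⟧] [FaithfulSMul Γ k⟦X⟧]

variable (k Γ) in
/-- `k[[z]]^Γ` is isomorphic to `k[[t]]`. -/
def invariantsEquiv [Fintype Γ] : k⟦X⟧ ≃ₐ[k] FixedPoints.subalgebra k k⟦X⟧ Γ :=
  AlgEquiv.ofBijective ((normHom k Γ).codRestrict _ fun P σ => smul_normHom σ P)
    ⟨fun P Q h => normHom_injective (congrArg Subtype.val h), fun y => by
      obtain ⟨P, hP⟩ := exists_normHom_eq (Γ := Γ) (y := (y : k⟦X⟧)) y.2
      exact ⟨P, Subtype.ext hP⟩⟩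

theorem coe_invariantsEquiv [Fintype Γ] (P : k⟦X⟧) :
    (invariantsEquiv k Γ P : k⟦X⟧) = normHom k Γ P := rfl

theorem isPrincipalIdealRing_invariants [Fintype Γ] :
    IsPrincipalIdealRing (FixedPoints.subalgebra k k⟦X⟧ Γ) :=
  IsPrincipalIdealRing.of_surjective (invariantsEquiv k Γ).toRingEquiv.toRingHom
    (invariantsEquiv k Γ).surjective

theorem order_of_irreducible_invariant [Fintype Γ] {t : FixedPoints.subalgebra k k⟦X⟧ Γ}
    (ht : Irreducible t) : (t : k⟦X⟧).order = Fintype.card Γ := by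
  obtain ⟨T, rfl⟩ := (invariantsEquiv k Γ).surjective t
  have hT : Irreducible T := (MulEquiv.irreducible_iff (invariantsEquiv k Γ)).1 ht
  have hT1 : T.order.toNat = 1 := by
    have h1 := (associated_X_pow_order hT.ne_zero).irreducible_iff.2 hT
    by_contra hne
    exact not_irreducible_pow hne h1
  rw [coe_invariantsEquiv, order_normHom hT.ne_zero, hT1, one_mul]

theorem adjoin_invariants_X [Fintype Γ] :
    Algebra.adjoin (FixedPoints.subalgebra k k⟦X⟧ Γ) {(X : k⟦X⟧)} = ⊤ := by
  rw [eq_top_iff]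
  rintro x -
  obtain ⟨P, rfl⟩ := exists_eq_sum_normHom (Γ := Γ) x
  refine Subalgebra.sum_mem _ fun i _ => Subalgebra.mul_mem _ ?_
    (Subalgebra.pow_mem _ (Algebra.self_mem_adjoin_singleton _ _) _)
  exact Subalgebra.algebraMap_mem _ (invariantsEquiv k Γ (P i))

open Classical in
theorem differentIdeal_invariants [Fintype Γ] :
    differentIdeal (FixedPoints.subalgebra k k⟦X⟧ Γ) k⟦X⟧ = IsLocalRing.maximalIdeal k⟦X⟧ ^
      (∑ σ : Γ with σ ≠ 1, (σ • (X : k⟦X⟧) - X).order.toNat) := by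
  have := isPrincipalIdealRing_invariants (k := k) (Γ := Γ)
  have hgal : IsGaloisGroup Γ (FixedPoints.subalgebra k k⟦X⟧ Γ) k⟦X⟧ :=
    { faithful := inferInstance
      commutes := ⟨fun σ a b => by
        rw [Algebra.smul_def, Algebra.smul_def, smul_mul']
        congr 1
        exact a.2 σ⟩
      isInvariant := ⟨fun b hb => ⟨⟨b, hb⟩, rfl⟩⟩ }
  rw [differentIdeal_eq_span_prod (smul_X_injective (k := k) (Γ := Γ)) adjoin_invariants_X,
    maximalIdeal_eq_span_X, Ideal.span_singleton_pow, Ideal.span_singleton_eq_span_singleton,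
    ← Finset.prod_pow_eq_pow_sum]
  refine (Associated.prod _ _ _ fun σ hσ => ?_).symm
  have hne : σ • (X : k⟦X⟧) - X ≠ 0 := fun h => (Finset.mem_filter.1 hσ).2
    (smul_X_injective (k := k) (Γ := Γ) (by simpa [sub_eq_zero] using h))
  refine (associated_X_pow_order hne).trans ?_
  rw [← neg_sub X]
  exact (Associated.refl _).neg_left

end PowerSeries

end

/-! ### Galois correspondence for the subcovers. -/

noncomputable section

namespace LocalCover

open PowerSeries

variable {k : Type*} [Field k]

instance laurentAction (G : Subgroup (k⟦X⟧ ≃ₐ[k] k⟦X⟧)) : MulSemiringAction G k⸨X⸩ :=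
  IsFractionRing.mulSemiringAction G k⟦X⟧ k⸨X⸩

variable {G : Subgroup (k⟦X⟧ ≃ₐ[k] k⟦X⟧)}

theorem smul_algebraMap (σ : G) (x : k⟦X⟧) :
    σ • algebraMap k⟦X⟧ k⸨X⸩ x = algebraMap k⟦X⟧ k⸨X⸩ (σ • x) :=
  (algebraMap.smul' σ x _).symm

theorem extendAut_eq_smul (σ : G) (x : k⸨X⸩) : extendAut (σ : k⟦X⟧ ≃ₐ[k] k⟦X⟧) x = σ • x := by
  obtain ⟨a, b, hb, rfl⟩ := IsFractionRing.div_surjective (A := k⟦X⟧) x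
  rw [smul_div₀', smul_algebraMap, smul_algebraMap, map_div₀, extendAut,
    IsFractionRing.ringEquivOfRingEquiv_algebraMap, IsFractionRing.ringEquivOfRingEquiv_algebraMap]
  rfl

theorem mem_invariantField {x : k⸨X⸩} : x ∈ invariantField G ↔ ∀ σ : G, σ • x = x :=
  ⟨fun h σ => (extendAut_eq_smul σ x).symm.trans (h σ σ.2),
    fun h σ hσ => (extendAut_eq_smul ⟨σ, hσ⟩ x).trans (h ⟨σ, hσ⟩)⟩

theorem mem_subcover {N : Subgroup G} {x : k⸨X⸩} :
    x ∈ subcover G N ↔ ∀ σ ∈ N, σ • x = x := by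
  change (∀ σ ∈ N.map G.subtype, extendAut σ x = x) ↔ _
  constructor
  · intro h σ hσ
    exact (extendAut_eq_smul σ x).symm.trans (h σ (Subgroup.mem_map_of_mem _ hσ))
  · rintro h _ ⟨σ, hσ, rfl⟩
    exact (extendAut_eq_smul σ x).trans (h σ hσ)

instance : IsGaloisGroup G (invariantField G) k⸨X⸩ where
  faithful := IsFractionRing.faithfulSMul G k⟦X⟧ k⸨X⸩
  commutes := ⟨fun σ a b => by
    rw [Algebra.smul_def, Algebra.smul_def, smul_mul']
    congr 1
    exact mem_invariantField.1 a.2 σ⟩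
  isInvariant := ⟨fun b hb => ⟨⟨b, mem_invariantField.2 hb⟩, rfl⟩⟩

theorem subcover_eq_fixedPoints (N : Subgroup G) :
    subcover G N = FixedPoints.intermediateField N := by
  ext x
  rw [mem_subcover]
  exact ⟨fun h σ => h σ σ.2, fun h σ hσ => h ⟨σ, hσ⟩⟩

theorem fixingSubgroup_subcover [Finite G] (N : Subgroup G) :
    fixingSubgroup G (subcover G N : Set k⸨X⸩) = N := by
  rw [subcover_eq_fixedPoints]
  exact IsGaloisGroup.fixingSubgroup_fixedPoints G (invariantField G) k⸨X⸩ N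

theorem adjoin_eq_subcover_iff [Finite G] {N : Subgroup G} {w : k⸨X⸩} :
    IntermediateField.adjoin (invariantField G) {w} = subcover G N ↔
      ∀ σ : G, σ • w = w ↔ σ ∈ N := by
  have hfix : ∀ σ : G, σ ∈ fixingSubgroup G
      (IntermediateField.adjoin (invariantField G) {w} : Set k⸨X⸩) ↔ σ • w = w := fun σ => by
    constructor
    · exact fun h => h ⟨w, IntermediateField.mem_adjoin_simple_self _ w⟩
    · intro h
      have hle : IntermediateField.adjoin (invariantField G) {w} ≤
          FixedPoints.intermediateField (Subgroup.zpowers σ) := by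
        rw [IntermediateField.adjoin_simple_le_iff]
        rintro ⟨τ, hτ⟩
        have : Subgroup.zpowers σ ≤ MulAction.stabilizer G w := by
          rw [Subgroup.zpowers_le]; exact h
        exact this hτ
      exact (IsGaloisGroup.le_fixedPoints_iff_le_fixingSubgroup G (invariantField G) k⸨X⸩
        (Subgroup.zpowers σ) _).1 hle (Subgroup.mem_zpowers σ)
  constructor
  · intro h σ
    rw [← hfix, h, fixingSubgroup_subcover]
  · intro h
    have hN : fixingSubgroup G
        (IntermediateField.adjoin (invariantField G) {w} : Set k⸨X⸩) = N := by
      ext σ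
      rw [hfix, h]
    rw [← IsGaloisGroup.fixedPoints_fixingSubgroup G (invariantField G) k⸨X⸩
      (IntermediateField.adjoin (invariantField G) {w}), subcover_eq_fixedPoints, hN]

/-- For a Galois subextension linear disjointness means trivial intersection, that is, N i and the
intersection of the preceding subgroups generate G. Since N i has prime index, it suffices that this
intersection is not inside N i. -/
theorem linearDisjoint_subcover_iff [Finite G] {p n : ℕ} (hp : p.Prime) (N : Fin n → Subgroup G)
    (i : Fin n) (hi : (N i).index = p) [(N i).Normal] :
    (⨆ j : Fin n, ⨆ _ : j < i, subcover G (N j)).LinearDisjoint (subcover G (N i)) ↔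
      ¬ (⨅ j : Fin n, ⨅ _ : j < i, N j) ≤ N i := by
  have := IsGaloisGroup.isGalois G (invariantField G) k⸨X⸩
  have := IsGaloisGroup.finiteDimensional G (invariantField G) k⸨X⸩
  let e := IsGaloisGroup.intermediateFieldEquivSubgroup G (invariantField G) k⸨X⸩
  have he : ∀ M : Subgroup G, e (subcover G M) = OrderDual.toDual M := fun M => by
    rw [subcover_eq_fixedPoints]
    exact congrArg OrderDual.toDual
      (IsGaloisGroup.fixingSubgroup_fixedPoints G (invariantField G) k⸨X⸩ M)
  have hgal : IsGalois (invariantField G) (subcover G (N i)) :=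
    { to_isSeparable := Algebra.isSeparable_tower_bot_of_isSeparable _ _ k⸨X⸩
      to_normal := by
        apply IntermediateField.normal_iff_forall_map_le'.mpr
        rintro g x ⟨a, ha, rfl⟩
        obtain ⟨σ, rfl⟩ :=
          (IsGaloisGroup.mulEquivAlgEquiv G (invariantField G) k⸨X⸩).surjective g
        refine mem_subcover.2 fun τ hτ => ?_
        have h1 := mem_subcover.1 ha (σ⁻¹ * τ * σ) (Subgroup.Normal.conj_mem' ‹_› τ hτ σ)
        change τ • σ • a = σ • a
        rw [mul_smul, mul_smul, inv_smul_eq_iff] at h1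
        exact h1 }
  rw [IntermediateField.linearDisjoint_comm, IntermediateField.LinearDisjoint.iff_inf_eq_bot,
    ← e.injective.eq_iff, e.map_bot, e.map_inf, e.map_iSup]
  simp only [e.map_iSup, he]
  change N i ⊔ (⨅ j : Fin n, ⨅ _ : j < i, N j) = ⊤ ↔ _
  constructor
  · intro h hle
    rw [sup_eq_left.2 hle] at h
    rw [h, Subgroup.index_top] at hi
    exact hp.one_lt.ne hi
  · intro h
    have h1 := Subgroup.relIndex_mul_index
      (le_sup_left : N i ≤ N i ⊔ (⨅ j : Fin n, ⨅ _ : j < i, N j))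
    rw [hi] at h1
    rcases (Nat.dvd_prime hp).1 (Dvd.intro_left _ h1) with h2 | h2
    · exact Subgroup.index_eq_one.1 h2
    · rw [h2] at h1
      have h3 := Nat.eq_of_mul_eq_mul_right hp.pos (h1.trans (one_mul p).symm)
      rw [Subgroup.relIndex_eq_one] at h3
      exact absurd (le_sup_right.trans h3) h

end LocalCover

end

/-! ### Artin–Schreier equations and conductors. -/

noncomputable section

namespace LocalCover

open PowerSeries

variable {k : Type*} [Field k]

/-- The constants of `k((z))`. -/
def laurentC : k →+* k⸨X⸩ := (algebraMap k⟦X⟧ k⸨X⸩).comp PowerSeries.C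

theorem laurentC_apply (a : k) : laurentC a = algebraMap k⟦X⟧ k⸨X⸩ (PowerSeries.C a) := rfl

theorem hahnSeriesC_eq : (HahnSeries.C : k →+* k⸨X⸩) = laurentC :=
  RingHom.ext fun a => (HahnSeries.ofPowerSeries_C a).symm

instance charP_laurentSeries (p : ℕ) [CharP k p] : CharP k⸨X⸩ p :=
  charP_of_injective_ringHom (laurentC (k := k)).injective p

theorem algebraMap_laurent_injective : Function.Injective (algebraMap k⟦X⟧ k⸨X⸩) :=
  IsFractionRing.injective _ _

/-- The prime field of `k((z))`. -/
def primeHom (p : ℕ) [CharP k p] : ZMod p →+* k⸨X⸩ := laurentC.comp (ZMod.castHom dvd_rfl k)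

theorem primeHom_injective (p : ℕ) [Fact p.Prime] [CharP k p] :
    Function.Injective (primeHom p : ZMod p →+* k⸨X⸩) := (primeHom p).injective

theorem exists_primeHom_eq {p : ℕ} [Fact p.Prime] [CharP k p] {a : k⸨X⸩} (ha : a ^ p = a) :
    ∃ z : ZMod p, primeHom p z = a := by
  rw [← Subfield.mem_bot_iff_pow_eq_self (F := k⸨X⸩) (p := p)] at ha
  have : (⊥ : Subfield k⸨X⸩) ≤ (primeHom p).fieldRange := bot_le
  exact this ha

theorem primeHom_pow {p : ℕ} [Fact p.Prime] [CharP k p] (z : ZMod p) :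
    (primeHom p z : k⸨X⸩) ^ p = primeHom p z := by
  rw [← map_pow, ZMod.pow_card]

variable {G : Subgroup (k⟦X⟧ ≃ₐ[k] k⟦X⟧)}

theorem smul_laurentC (σ : G) (a : k) : σ • (laurentC a : k⸨X⸩) = laurentC a := by
  rw [laurentC_apply, smul_algebraMap]
  congr 1
  exact (σ : k⟦X⟧ ≃ₐ[k] k⟦X⟧).commutes a

theorem smul_primeHom {p : ℕ} [CharP k p] (σ : G) (z : ZMod p) :
    σ • (primeHom p z : k⸨X⸩) = primeHom p z := smul_laurentC σ _

theorem exists_smul_sub_eq_primeHom {p : ℕ} [Fact p.Prime] [CharP k p] {w : k⸨X⸩}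
    (hw : w ^ p - w ∈ invariantField G) (σ : G) : ∃ z : ZMod p, primeHom p z = σ • w - w := by
  refine exists_primeHom_eq ?_
  have h := mem_invariantField.1 hw σ
  rw [smul_sub, smul_pow'] at h
  rw [sub_pow_char]
  linear_combination h

theorem smul_eval₂ {t : k⸨X⸩} {σ : G} (ht : σ • t = t) (f : Polynomial k) :
    σ • f.eval₂ laurentC t = f.eval₂ laurentC t := by
  rw [Polynomial.eval₂_eq_sum_range, Finset.smul_sum]
  simp only [smul_mul', smul_laurentC, smul_pow', ht]

/-- A solution of an Artin-Schreier equation with a pole is the inverse of a power series of known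
order. -/
theorem exists_inv_of_artinSchreier {p : ℕ} [hp : Fact p.Prime] {t : k⟦X⟧} {e : ℕ} (he : t.order = e)
    (he0 : 0 < e) {f : Polynomial k} (hf : 0 < f.natDegree) {w : k⸨X⸩}
    (hw : w ^ p - w = f.eval₂ laurentC (algebraMap k⟦X⟧ k⸨X⸩ t)⁻¹) :
    ∃ x : k⟦X⟧, algebraMap k⟦X⟧ k⸨X⸩ x * w = 1 ∧ constantCoeff x = 0 ∧
      x.order = (x.order.toNat : ℕ) ∧ p * x.order.toNat = f.natDegree * e := by
  set c := f.natDegree with hc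
  have ht0 : t ≠ 0 := by rintro rfl; rw [order_zero] at he; exact ENat.natCast_ne_top _ he.symm
  have htc : constantCoeff t = 0 := by
    rw [← order_ne_zero_iff_constCoeff_eq_zero, he]; exact_mod_cast he0.ne'
  set T : k⸨X⸩ := algebraMap k⟦X⟧ k⸨X⸩ t with hT
  have hT0 : T ≠ 0 := by
    rw [hT, Ne, map_eq_zero_iff _ algebraMap_laurent_injective]; exact ht0
  -- U is the reversed polynomial at t; its constant term is the leading coefficient of f.
  obtain ⟨U, hU, hUc⟩ : ∃ U : k⟦X⟧, IsUnit U ∧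
      T ^ c * f.eval₂ laurentC T⁻¹ = algebraMap k⟦X⟧ k⸨X⸩ U := by
    refine ⟨f.reverse.eval₂ PowerSeries.C t, ?_, ?_⟩
    · rw [isUnit_iff_constantCoeff, Polynomial.hom_eval₂, htc, Polynomial.eval₂_at_zero,
        isUnit_iff_ne_zero]
      have hf0 : f ≠ 0 := fun h => hf.ne' (by rw [hc, h, Polynomial.natDegree_zero])
      simpa using hf0
    · let : Invertible T⁻¹ := invertibleOfNonzero (inv_ne_zero hT0)
      have h := Polynomial.eval₂_reverse_mul_pow laurentC T⁻¹ f
      rw [invOf_eq_inv, inv_inv] at h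
      rw [← h, Polynomial.hom_eval₂, mul_comm, mul_assoc, ← mul_pow, inv_mul_cancel₀ hT0, one_pow,
        mul_one]
      rfl
  -- An integral w would make the unit U = t ^ c * (w ^ p - w) a multiple of t.
  have hnot : ∀ y : k⟦X⟧, algebraMap k⟦X⟧ k⸨X⸩ y ≠ w := by
    rintro y rfl
    rw [← hw, hT, ← map_pow, ← map_pow, ← map_sub, ← map_mul] at hUc
    have h := algebraMap_laurent_injective hUc
    rw [← h, isUnit_iff_constantCoeff] at hU
    simp [htc, hf.ne'] at hU
  have hw0 : w ≠ 0 := fun h => hnot 0 (by rw [map_zero, h])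
  obtain ⟨x, hx⟩ : ∃ x, algebraMap k⟦X⟧ k⸨X⸩ x = w⁻¹ := by
    rcases ValuationRing.isInteger_or_isInteger k⟦X⟧ w with ⟨y, hy⟩ | ⟨y, hy⟩
    · exact absurd hy (hnot y)
    · exact ⟨y, hy⟩
  have hx0 : constantCoeff x = 0 := by
    by_contra h
    obtain ⟨y, hy⟩ := (isUnit_iff_constantCoeff.2 (isUnit_iff_ne_zero.2 h)).exists_right_inv
    refine hnot y ?_
    have h2 := congrArg (algebraMap k⟦X⟧ k⸨X⸩) hy
    rw [map_mul, hx, map_one] at h2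
    field_simp at h2
    exact h2
  have hxne : x ≠ 0 := by
    rintro rfl
    rw [map_zero] at hx
    exact hw0 (inv_eq_zero.1 hx.symm)
  have hp1 := hp.out.one_lt
  have heq : t ^ c * (1 - x ^ (p - 1)) = U * x ^ p := by
    apply algebraMap_laurent_injective
    rw [map_mul, map_mul, map_sub, map_pow, map_pow, map_pow, map_one, hx, ← hUc, ← hw, ← hT,
      mul_assoc]
    congr 1
    obtain ⟨q, rfl⟩ : ∃ q, p = q + 1 := ⟨p - 1, by omega⟩
    rw [Nat.add_sub_cancel]
    have h3 : w * w⁻¹ = 1 := mul_inv_cancel₀ hw0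
    have h4 : w ^ (q + 1) * w⁻¹ ^ (q + 1) = 1 := by rw [← mul_pow, h3, one_pow]
    rw [pow_succ w⁻¹ q] at h4 ⊢
    linear_combination (w⁻¹ ^ q) * h3 - h4
  refine ⟨x, by rw [hx, inv_mul_cancel₀ hw0], hx0, (coe_toNat_order hxne).symm, ?_⟩
  have hunit : IsUnit (1 - x ^ (p - 1)) := by
    rw [isUnit_iff_constantCoeff, map_sub, map_pow, hx0, zero_pow (by omega)]
    simp
  have hord := congrArg PowerSeries.order heq
  rw [order_mul, order_mul, order_zero_of_unit hunit, order_zero_of_unit hU, order_pow, order_pow,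
    he, ← coe_toNat_order hxne] at hord
  simp only [nsmul_eq_mul, add_zero, zero_add] at hord
  exact_mod_cast hord.symm

/-- For an Artin–Schreier generator w one has s w = w + a with a a nonzero element of 𝔽_p. Hence x =
1/w satisfies s x - x = -a x² / (1 + a x), of twice the order of x, and
`sum_order_smul_sub_of_invariant` applies. -/
theorem sum_order_of_hasConductor {p : ℕ} [hp : Fact p.Prime] [CharP k p] [Fintype G]
    (hexp : ∀ σ : G, σ ^ p = 1) {N : Subgroup G} [Fintype N] (hN : N.index = p) {c : ℕ}
    (hc : HasConductor p G N (c + 1)) {s : G} (hs : s ∉ N) :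
    ∑ h : N, (s • (h : G) • (X : k⟦X⟧) - X).order =
      ((Fintype.card N * (c + 1) : ℕ) : ℕ∞) := by
  obtain ⟨t, f, w, ht, hpf, hcf, hw, hadj⟩ := hc
  obtain rfl : c = f.natDegree := by omega
  rw [hahnSeriesC_eq] at hw
  rw [adjoin_eq_subcover_iff] at hadj
  have hto := order_of_irreducible_invariant ht
  have hcard : Fintype.card G = p * Fintype.card N := by
    rw [← Nat.card_eq_fintype_card, ← Nat.card_eq_fintype_card, ← N.index_mul_card, hN]
  obtain ⟨x, hxw, hx0, hxo, hxe⟩ := exists_inv_of_artinSchreier (p := p) hto Fintype.card_pos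
    (Nat.pos_of_ne_zero fun h => hpf (by simp [h])) hw
  rw [hcard] at hxe
  have hxe' : x.order.toNat = f.natDegree * Fintype.card N :=
    Nat.eq_of_mul_eq_mul_left hp.out.pos (by rw [hxe]; ring)
  have hw0 : w ≠ 0 := right_ne_zero_of_mul_eq_one hxw
  have hxinv : algebraMap k⟦X⟧ k⸨X⸩ x = w⁻¹ := eq_inv_of_mul_eq_one_left hxw
  have hwK : w ^ p - w ∈ invariantField G := by
    rw [hw, mem_invariantField]
    intro σ
    refine smul_eval₂ ?_ f
    rw [smul_inv'', smul_algebraMap]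
    congr 2
    exact t.2 σ
  obtain ⟨z, hz⟩ := exists_smul_sub_eq_primeHom hwK s
  set a : k := ZMod.castHom dvd_rfl k z
  have ha0 : a ≠ 0 := by
    intro h
    have h1 : (primeHom p z : k⸨X⸩) = 0 := by
      change laurentC a = 0
      rw [h, map_zero]
    rw [h1] at hz
    exact hs ((hadj s).1 (sub_eq_zero.1 hz.symm))
  have hsx : (s • x - x) * (1 + PowerSeries.C a * x) = - (PowerSeries.C a * x ^ 2) := by
    have h1 : s • x * (1 + PowerSeries.C a * x) = x := by
      apply algebraMap_laurent_injective
      have h2 : algebraMap k⟦X⟧ k⸨X⸩ (s • x) * (w + laurentC a) = 1 := by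
        have h3 := congrArg (fun y => s • y) hxw
        simp only [smul_mul', smul_algebraMap, smul_one] at h3
        rw [show s • w = w + laurentC a by
          change laurentC a = _ at hz
          rw [hz]; ring] at h3
        exact h3
      rw [map_mul, map_add, map_mul, map_one, ← laurentC_apply]
      linear_combination (algebraMap k⟦X⟧ k⸨X⸩ x) * h2 - (algebraMap k⟦X⟧ k⸨X⸩ (s • x)) * hxw
    linear_combination h1
  refine sum_order_smul_sub_of_invariant N (fun σ => X_sq_dvd_smul_X_sub_X (hexp σ)) s (x := x)
    (c := f.natDegree) (fun h => ?_) ?_ (by rw [hxo, hxe']) ?_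
  · apply algebraMap_laurent_injective
    change algebraMap k⟦X⟧ k⸨X⸩ ((h : G) • x) = _
    rw [← smul_algebraMap, hxinv, smul_inv'', (hadj h).2 h.2]
  · rwa [Ne, CharP.cast_eq_zero_iff k p]
  · have hu1 : IsUnit (1 + PowerSeries.C a * x) := by
      rw [isUnit_iff_constantCoeff]; simp [hx0]
    have hu2 : IsUnit (PowerSeries.C a : k⟦X⟧) := by
      rw [isUnit_iff_constantCoeff]; simpa using ha0
    have h1 := congrArg PowerSeries.order hsx
    rw [order_neg, order_mul, order_mul, order_pow, order_zero_of_unit hu1,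
      order_zero_of_unit hu2, hxo, hxe', add_zero, zero_add] at h1
    rw [h1]
    simp

/-- The element `1 / t` of `k((z))^G`, for `t` the norm of `z`. -/
abbrev invNormX (G : Subgroup (k⟦X⟧ ≃ₐ[k] k⟦X⟧)) [Fintype G] : k⸨X⸩ :=
  (algebraMap k⟦X⟧ k⸨X⸩ (normX k G))⁻¹

theorem smul_invNormX [Fintype G] (σ : G) : σ • invNormX G = invNormX G := by
  rw [smul_inv'', smul_algebraMap, smul_normX]

theorem algebraMap_normX_ne_zero [Fintype G] : algebraMap k⟦X⟧ k⸨X⸩ (normX k G) ≠ 0 := by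
  rw [Ne, map_eq_zero_iff _ algebraMap_laurent_injective]
  exact normX_ne_zero

theorem exists_polar_part_of_pow [Fintype G] (M : ℕ) (P : k⟦X⟧) : ∃ (f : Polynomial k) (Q : k⟦X⟧),
    algebraMap k⟦X⟧ k⸨X⸩ (normHom k G P) * invNormX G ^ M =
      f.eval₂ laurentC (invNormX G) + algebraMap k⟦X⟧ k⸨X⸩ (normHom k G Q) := by
  induction M generalizing P with
  | zero => exact ⟨0, P, by simp⟩
  | succ M ih =>
    have hP : normHom k G P = PowerSeries.C (constantCoeff P) +
        normX k G * normHom k G (mk fun i => coeff (i + 1) P) := by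
      conv_lhs => rw [eq_X_mul_shift_add_const P]
      rw [map_add, map_mul, evalHom_X, add_comm]
      congr 1
      exact (normHom k G).commutes _
    obtain ⟨f, Q, hf⟩ := ih (mk fun i => coeff (i + 1) P)
    refine ⟨Polynomial.C (constantCoeff P) * Polynomial.X ^ (M + 1) + f, Q, ?_⟩
    have h1 : algebraMap k⟦X⟧ k⸨X⸩ (normX k G) * invNormX G = 1 :=
      mul_inv_cancel₀ algebraMap_normX_ne_zero
    rw [Polynomial.eval₂_add, Polynomial.eval₂_mul, Polynomial.eval₂_C, Polynomial.eval₂_X_pow,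
      add_assoc, ← hf, hP, map_add, map_mul, ← laurentC_apply, pow_succ]
    linear_combination (algebraMap k⟦X⟧ k⸨X⸩ (normHom k G (mk fun i => coeff (i + 1) P))
      * invNormX G ^ M) * h1

theorem exists_polar_part [Fintype G] {g : k⸨X⸩} (hg : g ∈ invariantField G) :
    ∃ (f : Polynomial k) (Q : k⟦X⟧),
      g = f.eval₂ laurentC (invNormX G) + algebraMap k⟦X⟧ k⸨X⸩ (normHom k G Q) := by
  obtain ⟨a, b, hb, rfl⟩ := IsFractionRing.div_surjective (A := k⟦X⟧) g
  have hb0 : b ≠ 0 := nonZeroDivisors.ne_zero hb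
  obtain ⟨d, hd⟩ : b ∣ normX k G ^ b.order.toNat :=
    (associated_X_pow_order hb0).dvd'.trans (pow_dvd_pow_of_dvd
      (X_dvd_iff.2 constantCoeff_normX) _)
  have hbL : algebraMap k⟦X⟧ k⸨X⸩ b ≠ 0 := by
    rwa [Ne, map_eq_zero_iff _ algebraMap_laurent_injective]
  have hdL := congrArg (algebraMap k⟦X⟧ k⸨X⸩) hd
  rw [map_mul, map_pow] at hdL
  have h1 : algebraMap k⟦X⟧ k⸨X⸩ (a * d) = algebraMap k⟦X⟧ k⸨X⸩ a / algebraMap k⟦X⟧ k⸨X⸩ b *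
      algebraMap k⟦X⟧ k⸨X⸩ (normX k G) ^ b.order.toNat := by
    rw [hdL, map_mul]
    field_simp
  obtain ⟨P, hP⟩ : ∃ P, normHom k G P = a * d := by
    refine exists_normHom_eq fun σ => ?_
    apply algebraMap_laurent_injective
    rw [← smul_algebraMap, h1, smul_mul', mem_invariantField.1 hg σ, smul_pow', smul_algebraMap,
      smul_normX]
  obtain ⟨f, Q, hf⟩ := exists_polar_part_of_pow (G := G) b.order.toNat P
  refine ⟨f, Q, ?_⟩
  rw [← hf, hP, h1, mul_assoc, ← mul_pow, mul_inv_cancel₀ algebraMap_normX_ne_zero, one_pow,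
    mul_one]

theorem monic_artinSchreier {R : Type*} [CommRing R] [Nontrivial R] {p : ℕ} (hp : 1 < p) (y : R) :
    (Polynomial.X ^ p - Polynomial.X - Polynomial.C y : Polynomial R).Monic := by
  rw [sub_sub]
  refine Polynomial.monic_X_pow_sub ?_
  rw [Polynomial.degree_X_add_C]
  exact_mod_cast hp

theorem exists_root_artinSchreier [IsAlgClosed k] {p : ℕ} (hp : 1 < p) (a : k) :
    ∃ β : k, β ^ p - β = a := by
  have hm := monic_artinSchreier hp a
  obtain ⟨β, hβ⟩ := IsAlgClosed.exists_root
    (Polynomial.X ^ p - Polynomial.X - Polynomial.C a : Polynomial k) fun h => by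
      have h1 := Polynomial.eq_one_of_monic_natDegree_zero hm (Polynomial.natDegree_eq_of_degree_eq_some h)
      have h2 := congrArg (Polynomial.coeff · p) h1
      simp [Polynomial.coeff_X, Polynomial.coeff_C, Polynomial.coeff_one, hp.ne,
        (zero_lt_one.trans hp).ne'] at h2
  exact ⟨β, by simpa [Polynomial.IsRoot, sub_eq_zero] using hβ⟩

/-- Hensel's lemma applies because T ^ p - T - y has derivative -1. The integral part of an
Artin–Schreier equation can therefore be removed, leaving its polar part. -/
theorem exists_pow_sub_self_eq (p : ℕ) [hp : Fact p.Prime] [CharP k p] [IsAlgClosed k]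
    (y : k⟦X⟧) : ∃ b : k⟦X⟧, b ^ p - b = y := by
  obtain ⟨β, hβ⟩ := exists_root_artinSchreier hp.out.one_lt (constantCoeff y)
  let q : Polynomial k⟦X⟧ := Polynomial.X ^ p - Polynomial.X - Polynomial.C y
  have hp0 : (p : k⟦X⟧) = 0 := by
    have h := congrArg (PowerSeries.C (R := k)) (CharP.cast_eq_zero k p)
    rwa [map_natCast, map_zero] at h
  have hder : q.derivative = -1 := by
    simp [q, Polynomial.derivative_X_pow, hp0]
  obtain ⟨b, hb, -⟩ := HenselianRing.is_henselian (I := Ideal.span {(X : k⟦X⟧)}) q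
    (monic_artinSchreier hp.out.one_lt y) (PowerSeries.C β) (by
      rw [Ideal.mem_span_singleton, X_dvd_iff]
      simp [q, hβ]) (by
      rw [hder]; simp)
  exact ⟨b, by simpa [q, Polynomial.IsRoot, sub_eq_zero] using hb⟩

/-- A nontrivial Artin-Schreier extension of `k((t))` can be given by a polynomial in `1 / t` of
degree prime to `p`. -/
theorem exists_reduced_polynomial {p : ℕ} [hp : Fact p.Prime] [CharP k p] [IsAlgClosed k]
    [Fintype G] {w : k⸨X⸩} (hw : w ∉ invariantField G) (f : Polynomial k) {b : k⸨X⸩}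
    (hb : b ∈ invariantField G)
    (hf : w ^ p - w = f.eval₂ laurentC (invNormX G) + (b ^ p - b)) :
    ∃ (f' : Polynomial k) (b' : k⸨X⸩), b' ∈ invariantField G ∧ ¬ p ∣ f'.natDegree ∧
      w ^ p - w = f'.eval₂ laurentC (invNormX G) + (b' ^ p - b') := by
  induction hd : f.natDegree using Nat.strong_induction_on generalizing f b with
  | _ d ih =>
    by_cases hpd : p ∣ d
    swap
    · exact ⟨f, b, hb, hd ▸ hpd, hf⟩
    obtain ⟨r, rfl⟩ := hpd
    rcases Nat.eq_zero_or_pos r with rfl | hr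
    -- For constant f, w - b solves an Artin–Schreier equation over k, hence is constant, and w
    -- would be invariant.
    · exfalso
      rw [mul_zero] at hd
      rw [Polynomial.eq_C_of_natDegree_eq_zero hd, Polynomial.eval₂_C] at hf
      obtain ⟨β, hβ⟩ := exists_root_artinSchreier hp.out.one_lt (f.coeff 0)
      have h1 : (w - b - laurentC β) ^ p = w - b - laurentC β := by
        rw [← hβ, map_sub, map_pow] at hf
        rw [sub_pow_char, sub_pow_char]
        linear_combination hf
      obtain ⟨z, hz⟩ := exists_primeHom_eq h1
      refine hw (mem_invariantField.2 fun σ => ?_)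
      rw [show w = primeHom p z + laurentC β + b by rw [hz]; ring, smul_add, smul_add,
        smul_primeHom, smul_laurentC, mem_invariantField.1 hb σ]
    -- A leading term (β t⁻ʳ) ^ p may be traded for β t⁻ʳ by adding β t⁻ʳ to b, which lowers the
    -- degree.
    · obtain ⟨β, hβ⟩ := IsAlgClosed.exists_pow_nat_eq f.leadingCoeff hp.out.pos
      have hlt : (f.eraseLead + Polynomial.C β * Polynomial.X ^ r).natDegree < p * r := by
        have hp1 := hp.out.one_lt
        refine (Polynomial.natDegree_add_le _ _).trans_lt (max_lt ?_ ?_)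
        · have := Polynomial.eraseLead_natDegree_le f
          have : 0 < p * r := by positivity
          omega
        · refine (Polynomial.natDegree_C_mul_X_pow_le β r).trans_lt ?_
          nlinarith
      refine ih _ hlt (f.eraseLead + Polynomial.C β * Polynomial.X ^ r)
        (b := b + laurentC β * invNormX G ^ r) ?_ ?_ rfl
      · refine add_mem hb (mem_invariantField.2 fun σ => ?_)
        rw [smul_mul', smul_laurentC, smul_pow', smul_invNormX]
      · rw [hf]
        conv_lhs => rw [← Polynomial.eraseLead_add_C_mul_X_pow f, hd, ← hβ, Polynomial.C_pow]
        rw [add_pow_char]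
        simp only [Polynomial.eval₂_add, Polynomial.eval₂_mul, Polynomial.eval₂_C,
          Polynomial.eval₂_X, Polynomial.eval₂_pow, mul_pow, ← pow_mul, mul_comm r p]
        ring

theorem exists_hasConductor {p : ℕ} [hp : Fact p.Prime] [CharP k p] [IsAlgClosed k]
    [Fintype G] {w : k⸨X⸩} (hwK : w ^ p - w ∈ invariantField G) {N : Subgroup G}
    (hN : ∀ σ : G, σ • w = w ↔ σ ∈ N) (hN1 : N ≠ ⊤) : ∃ c, HasConductor p G N (c + 1) := by
  have hw : w ∉ invariantField G := fun h => hN1 <| by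
    rw [Subgroup.eq_top_iff']
    exact fun σ => (hN σ).1 (mem_invariantField.1 h σ)
  obtain ⟨f, Q, hf⟩ := exists_polar_part hwK
  obtain ⟨q, rfl⟩ := exists_pow_sub_self_eq p Q
  obtain ⟨f', b, hb, hpf, hf'⟩ := exists_reduced_polynomial hw f
    (b := algebraMap k⟦X⟧ k⸨X⸩ (normHom k G q))
    (mem_invariantField.2 fun σ => by rw [smul_algebraMap, smul_normHom])
    (by rw [hf]; simp only [map_sub, map_pow])
  refine ⟨f'.natDegree, invariantsEquiv k G X, f', w - b, ?_, hpf, rfl, ?_, ?_⟩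
  · exact (MulEquiv.irreducible_iff (invariantsEquiv k G)).2 X_irreducible
  · rw [hahnSeriesC_eq, coe_invariantsEquiv, evalHom_X, sub_pow_char]
    linear_combination hf'
  · rw [adjoin_eq_subcover_iff]
    intro σ
    rw [← hN, smul_sub, mem_invariantField.1 hb σ, sub_left_inj]

end LocalCover

end

/-! ### Coordinates on G and the exchange argument. -/

noncomputable section

/-- Steinitz exchange: a takes position l, and the unit vector it displaces moves to position j,
where a is nonzero. The vector v witnesses that row i is independent of the earlier rows, the form
in which linear disjointness is tested. -/
theorem exists_dotProduct_of_replace {F : Type*} [Field F] {n : ℕ} {a : Fin n → F} {l j : Fin n}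
    (hlj : l ≤ j) (ha : a j ≠ 0) (i : Fin n) :
    ∃ v : Fin n → F,
      (∀ r < i, Function.update (Function.update (fun i => Pi.single i (1 : F)) j
        (Pi.single l 1)) l a r ⬝ᵥ v = 0) ∧
      Function.update (Function.update (fun i => Pi.single i (1 : F)) j
        (Pi.single l 1)) l a i ⬝ᵥ v ≠ 0 := by
  have hA : ∀ (r : Fin n) (v : Fin n → F), Function.update (Function.update
      (fun i => Pi.single i (1 : F)) j (Pi.single l 1)) l a r ⬝ᵥ v =
      if r = l then a ⬝ᵥ v else if r = j then v l else v r := by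
    intro r v
    simp only [Function.update_apply]
    split_ifs <;> simp
  simp only [hA]
  rcases lt_trichotomy i l with h | rfl | h
  · refine ⟨Pi.single i 1, fun r hr => ?_, ?_⟩
    · rw [if_neg (hr.trans h).ne, if_neg (hr.trans (h.trans_le hlj)).ne, Pi.single_eq_of_ne hr.ne]
    · rw [if_neg h.ne, if_neg (h.trans_le hlj).ne, Pi.single_eq_same]
      exact one_ne_zero
  · refine ⟨Pi.single j 1, fun r hr => ?_, ?_⟩
    · rw [if_neg hr.ne, if_neg (hr.trans_le hlj).ne, Pi.single_eq_of_ne (hr.trans_le hlj).ne]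
    · simpa using ha
  -- Past position l the witness must also be killed by a; the j-th coordinate corrects for this.
  · have hdot : ∀ i, a ⬝ᵥ (Pi.single i 1 - (a i / a j) • Pi.single j 1) = 0 := fun i => by
      rw [dotProduct_sub, dotProduct_smul, dotProduct_single, dotProduct_single, mul_one, smul_eq_mul,
        mul_one, div_mul_cancel₀ _ ha, sub_self]
    by_cases hij : i = j
    · subst hij
      refine ⟨Pi.single l 1 - (a l / a i) • Pi.single i 1, fun r hr => ?_, ?_⟩
      · split_ifs with h1 h2
        · exact hdot l
        · exact absurd h2 hr.ne
        · simp [h1, h2]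
      · simp [h.ne, h.ne']
    · refine ⟨Pi.single i 1 - (a i / a j) • Pi.single j 1, fun r hr => ?_, ?_⟩
      · split_ifs with h1 h2
        · exact hdot i
        · have : l ≠ j := fun e => h1 (h2.trans e.symm)
          simp [h.ne, this]
        · simp [hr.ne, h2]
      · simp [h.ne', hij]

namespace LocalCover

open PowerSeries

variable {k : Type*} [Field k] {G : Subgroup (k⟦X⟧ ≃ₐ[k] k⟦X⟧)}

theorem HasConductor.exists_generator {p : ℕ} [Finite G] {N : Subgroup G} {c : ℕ}
    (hc : HasConductor p G N c) : ∃ w : k⸨X⸩, w ^ p - w ∈ invariantField G ∧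
      ∀ σ : G, σ • w = w ↔ σ ∈ N := by
  obtain ⟨t, f, w, ht, hpf, hcf, hw, hadj⟩ := hc
  refine ⟨w, ?_, adjoin_eq_subcover_iff.1 hadj⟩
  rw [hw, hahnSeriesC_eq, mem_invariantField]
  intro σ
  refine smul_eval₂ ?_ f
  rw [smul_inv'', smul_algebraMap]
  congr 2
  exact t.2 σ

/-- Coordinates on `G ≅ (ℤ/p)^n` given by the Artin-Schreier characters of an admissible tuple of
subgroups. -/
theorem IsAdmissible.exists_coordinates {p : ℕ} [hp : Fact p.Prime] [CharP k p] {n : ℕ} [Finite G]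
    (hG : Nonempty (G ≃* Multiplicative (Fin n → ZMod p))) {m : Fin n → ℕ} {N : Fin n → Subgroup G}
    (h : IsAdmissible p G m N) :
    ∃ (e : G ≃ (Fin n → ZMod p)) (w : Fin n → k⸨X⸩), (∀ σ τ, e (σ * τ) = e σ + e τ) ∧
      (∀ i, w i ^ p - w i ∈ invariantField G) ∧
      (∀ i σ, primeHom p (e σ i) = σ • w i - w i) ∧ ∀ i σ, σ ∈ N i ↔ e σ i = 0 := by
  obtain ⟨g⟩ := hG
  choose w hwK hwN using fun i => (h.conductor i).exists_generator
  choose χ hχ using fun σ i => exists_smul_sub_eq_primeHom (p := p) (hwK i) σ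
  have hmul : ∀ σ τ, χ (σ * τ) = χ σ + χ τ := fun σ τ => by
    ext i
    apply primeHom_injective (k := k) p
    rw [Pi.add_apply, map_add, hχ, hχ, hχ, mul_smul]
    have h1 := smul_primeHom (G := G) σ (χ τ i)
    rw [hχ, smul_sub] at h1
    linear_combination h1
  have hmem : ∀ i σ, σ ∈ N i ↔ χ σ i = 0 := fun i σ => by
    rw [← hwN, ← sub_eq_zero, ← hχ, map_eq_zero_iff _ (primeHom_injective p)]
  have hnormal : ∀ i, (N i).Normal := fun i => ⟨fun x hx y => by
    have : y * x * y⁻¹ = x := g.injective (by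
      rw [map_mul, map_mul, map_inv, mul_comm (g y), mul_inv_cancel_right])
    rwa [this]⟩
  have hone : χ 1 = 0 := by
    have := hmul 1 1
    rwa [mul_one, left_eq_add] at this
  have hinv : ∀ σ, χ σ⁻¹ = -χ σ := fun σ => by
    rw [eq_neg_iff_add_eq_zero, ← hmul, inv_mul_cancel, hone]
  -- A proper image gives a linear relation among the characters. At its last nonzero coefficient i,
  -- the earlier N j intersect inside N i, contradicting linear disjointness.
  have hsurj : Function.Surjective χ := by
    by_contra hns
    obtain ⟨v, hv⟩ := not_forall.1 hns
    let I : AddSubgroup (Fin n → ZMod p) :=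
      { carrier := Set.range χ
        add_mem' := by rintro _ _ ⟨σ, rfl⟩ ⟨τ, rfl⟩; exact ⟨σ * τ, hmul σ τ⟩
        zero_mem' := ⟨1, hone⟩
        neg_mem' := by rintro _ ⟨σ, rfl⟩; exact ⟨σ⁻¹, hinv σ⟩ }
    obtain ⟨a, hav, haI⟩ := exists_dotProduct_separating I (v := v) fun hvI => hv hvI
    obtain ⟨i, hai, hi⟩ : ∃ i, a i ≠ 0 ∧ ∀ r, i < r → a r = 0 := by
      obtain ⟨i, hi⟩ := Function.ne_iff.1 (show a ≠ 0 by rintro rfl; simp at hav)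
      have hne : (Finset.univ.filter fun i => a i ≠ 0).Nonempty := ⟨i, by simpa using hi⟩
      refine ⟨_, (Finset.mem_filter.1 (Finset.max'_mem _ hne)).2, fun r hr => ?_⟩
      by_contra h
      exact absurd (Finset.le_max' _ r (by simpa using h)) (not_le.2 hr)
    refine (linearDisjoint_subcover_iff hp.out N i (h.index_eq i)).1 (h.linearDisjoint i) ?_
    intro σ hσ
    simp only [Subgroup.mem_iInf] at hσ
    rw [hmem]
    have h1 := haI (χ σ) ⟨σ, rfl⟩
    rw [dotProduct, Finset.sum_eq_single_of_mem i (Finset.mem_univ i)] at h1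
    · exact (mul_eq_zero.1 h1).resolve_left hai
    · intro r _ hr
      rcases lt_or_gt_of_ne hr with h2 | h2
      · rw [(hmem r σ).1 (hσ r h2), mul_zero]
      · rw [hi r h2, zero_mul]
  have hcard : Nat.card G = Nat.card (Fin n → ZMod p) := Nat.card_congr g.toEquiv
  have hbij : Function.Bijective χ := by
    have := Fintype.ofFinite G
    rw [Nat.card_eq_fintype_card, Nat.card_eq_fintype_card] at hcard
    exact (Fintype.bijective_iff_surjective_and_card _).2 ⟨hsurj, hcard⟩
  exact ⟨Equiv.ofBijective χ hbij, w, hmul, hwK, fun i σ => hχ σ i, hmem⟩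

section Coordinates

variable {p : ℕ} {n : ℕ} (e : G ≃ (Fin n → ZMod p))
  (he : ∀ σ τ, e (σ * τ) = e σ + e τ)

include he

theorem coord_one : e 1 = 0 := by
  have := he 1 1
  rwa [mul_one, left_eq_add] at this

theorem coord_inv (σ : G) : e σ⁻¹ = -e σ := by
  rw [eq_neg_iff_add_eq_zero, ← he, inv_mul_cancel, coord_one e he]

theorem coord_pow (σ : G) (r : ℕ) : e (σ ^ r) = r • e σ := by
  induction r with
  | zero => simp [coord_one e he]
  | succ r ih => rw [pow_succ, he, ih, succ_nsmul]

theorem coord_symm_add (u v : Fin n → ZMod p) : e.symm (u + v) = e.symm u * e.symm v :=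
  e.injective (by rw [he]; simp)

theorem pow_eq_one_of_coord (σ : G) : σ ^ p = 1 :=
  e.injective (by rw [coord_pow e he, coord_one e he]; ext; simp)

end Coordinates

/-- The hyperplane of `G` with equation `a` in the coordinates `e`. -/
def hyperplane {p n : ℕ} (e : G ≃ (Fin n → ZMod p)) (he : ∀ σ τ, e (σ * τ) = e σ + e τ)
    (a : Fin n → ZMod p) : Subgroup G where
  carrier := {σ | a ⬝ᵥ e σ = 0}
  mul_mem' {σ τ} hσ hτ := by
    rw [Set.mem_ofPred_eq] at *
    rw [he, dotProduct_add, hσ, hτ, add_zero]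
  one_mem' := by rw [Set.mem_ofPred_eq, coord_one e he, dotProduct_zero]
  inv_mem' {σ} hσ := by
    rw [Set.mem_ofPred_eq] at *
    rw [coord_inv e he, dotProduct_neg, hσ, neg_zero]

section Hyperplane

variable {p n : ℕ} {e : G ≃ (Fin n → ZMod p)} {he : ∀ σ τ, e (σ * τ) = e σ + e τ}

theorem mem_hyperplane {a : Fin n → ZMod p} {σ : G} :
    σ ∈ hyperplane e he a ↔ a ⬝ᵥ e σ = 0 := Iff.rfl

theorem hyperplane_normal (a : Fin n → ZMod p) : (hyperplane e he a).Normal :=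
  ⟨fun x hx y => by
    rw [mem_hyperplane] at hx ⊢
    rw [he, he, coord_inv e he, add_comm (e y), add_neg_cancel_right, hx]⟩

theorem index_hyperplane [Fact p.Prime] {a : Fin n → ZMod p} (ha : a ≠ 0) :
    (hyperplane e he a).index = p := by
  let f : G →* Multiplicative (ZMod p) :=
    { toFun := fun σ => Multiplicative.ofAdd (a ⬝ᵥ e σ)
      map_one' := by rw [coord_one e he, dotProduct_zero]; rfl
      map_mul' := fun σ τ => by rw [he, dotProduct_add]; rfl }
  have hf : f.ker = hyperplane e he a := by
    ext σ
    rw [MonoidHom.mem_ker]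
    exact Iff.rfl
  have hs : Function.Surjective f := fun z => by
    obtain ⟨i, hi⟩ := Function.ne_iff.1 ha
    refine ⟨e.symm (Pi.single i (Multiplicative.toAdd z / a i)), ?_⟩
    change Multiplicative.ofAdd (a ⬝ᵥ e (e.symm _)) = z
    rw [Equiv.apply_symm_apply, dotProduct_single, mul_div_cancel₀ _ hi]
    rfl
  rw [← hf, Subgroup.index_ker, MonoidHom.range_eq_top.2 hs, Subgroup.card_top]
  change Nat.card (ZMod p) = p
  exact Nat.card_zmod p

/-- The combination Σ a_i w_i is again an Artin–Schreier generator, and σ moves it by a ⬝ᵥ e σ. -/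
theorem exists_hasConductor_hyperplane [Fact p.Prime] [CharP k p] [IsAlgClosed k] [Fintype G]
    {w : Fin n → k⸨X⸩} (hwK : ∀ i, w i ^ p - w i ∈ invariantField G)
    (hew : ∀ i σ, primeHom p (e σ i) = σ • w i - w i) {a : Fin n → ZMod p} (ha : a ≠ 0) :
    ∃ c, HasConductor p G (hyperplane e he a) (c + 1) := by
  refine exists_hasConductor (w := ∑ i, primeHom p (a i) * w i) ?_ (fun σ => ?_) fun h => ?_
  · have h1 : (∑ i, primeHom p (a i) * w i) ^ p - ∑ i, primeHom p (a i) * w i =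
        ∑ i, primeHom p (a i) * (w i ^ p - w i) := by
      rw [sum_pow_char p, ← Finset.sum_sub_distrib]
      refine Finset.sum_congr rfl fun i _ => ?_
      rw [mul_pow, primeHom_pow, mul_sub]
    rw [h1]
    exact sum_mem fun i _ => mul_mem (mem_invariantField.2 fun σ => smul_primeHom σ _) (hwK i)
  · have h1 : σ • (∑ i, primeHom p (a i) * w i) - ∑ i, primeHom p (a i) * w i =
        (primeHom p (a ⬝ᵥ e σ) : k⸨X⸩) := by
      rw [Finset.smul_sum, ← Finset.sum_sub_distrib, dotProduct, map_sum]
      refine Finset.sum_congr rfl fun i _ => ?_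
      rw [smul_mul', smul_primeHom, map_mul, hew, mul_sub]
    rw [← sub_eq_zero, h1, map_eq_zero_iff _ (primeHom_injective p), mem_hyperplane]
  · have h2 := index_hyperplane (e := e) (he := he) ha
    rw [h, Subgroup.index_top] at h2
    exact (Fact.out : p.Prime).one_lt.ne h2

/-- If c < m l, the exchange puts this hyperplane at position l and moves N l to position j ≥ l. The
new admissible tuple agrees with m before l and is smaller at l, so it is lexicographically smaller.
-/
theorem IsCoverOfType.le_conductor [hp : Fact p.Prime] [Finite G] {m : Fin n → ℕ}
    {N : Fin n → Subgroup G} (hm : IsCoverOfType p G m N) (hN : ∀ i σ, σ ∈ N i ↔ e σ i = 0)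
    {a : Fin n → ZMod p} {l j : Fin n} (hlj : l ≤ j) (ha : a j ≠ 0) {c : ℕ}
    (hc : HasConductor p G (hyperplane e he a) (c + 1)) : m l ≤ c := by
  by_contra! hlt
  set A : Fin n → Fin n → ZMod p := Function.update (Function.update
    (fun i => Pi.single i (1 : ZMod p)) j (Pi.single l 1)) l a with hA
  have hNe : ∀ i, hyperplane e he (Pi.single i 1) = N i := fun i => by
    ext σ
    rw [mem_hyperplane, hN, single_dotProduct, one_mul]
  have hA0 : ∀ i, A i ≠ 0 := fun i h => by
    obtain ⟨v, -, hv⟩ := exists_dotProduct_of_replace hlj ha i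
    rw [← hA, h, zero_dotProduct] at hv
    exact hv rfl
  have hadm : IsAdmissible p G (Function.update (Function.update m j (m l)) l c)
      (fun i => hyperplane e he (A i)) :=
    { index_eq := fun i => index_hyperplane (hA0 i)
      conductor := fun i => by
        simp only [hA, Function.update_apply]
        split_ifs
        · exact hc
        · rw [hNe]; exact hm.admissible.conductor l
        · rw [hNe]; exact hm.admissible.conductor i
      linearDisjoint := fun i => by
        have := hyperplane_normal (he := he) (A i)
        rw [linearDisjoint_subcover_iff hp.out (fun i => hyperplane e he (A i)) i
          (index_hyperplane (hA0 i))]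
        obtain ⟨v, hv, hvi⟩ := exists_dotProduct_of_replace hlj ha i
        intro hle
        refine hvi ?_
        have h1 : e.symm v ∈ hyperplane e he (A i) := hle (by
          simp only [Subgroup.mem_iInf, mem_hyperplane, Equiv.apply_symm_apply]
          exact hv)
        rwa [mem_hyperplane, Equiv.apply_symm_apply] at h1 }
  refine absurd (hm.lex_le _ _ hadm) (not_le.2 ⟨l, fun r hr => ?_, ?_⟩)
  · change Function.update (Function.update m j (m l)) l c r = m r
    rw [Function.update_of_ne hr.ne, Function.update_of_ne (hr.trans_le hlj).ne]
  · change Function.update (Function.update m j (m l)) l c l < m l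
    rwa [Function.update_self]

end Hyperplane

end LocalCover

end

/-! ### Depth, p-ranks and lower ramification jumps. -/

noncomputable section

namespace LocalCover

theorem pow_le_card_of_injective (p : ℕ) [hp : Fact p.Prime] (H : Type*) [Group H] [Finite H] {r : ℕ}
    (f : Multiplicative (Fin r → ZMod p) →* H) (hf : Function.Injective f) :
    p ^ r ≤ Nat.card H := by
  have := Nat.card_le_card_of_injective f hf
  have h2 : Nat.card (Multiplicative (Fin r → ZMod p)) = p ^ r := by
    change Nat.card (Fin r → ZMod p) = p ^ r
    rw [Nat.card_eq_fintype_card]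
    simp [ZMod.card]
  rwa [h2] at this

theorem pRank_le {p : ℕ} [hp : Fact p.Prime] {H : Type*} [Group H] [Finite H] {r : ℕ}
    (h : Nat.card H ≤ p ^ r) : pRank p H ≤ r := by
  refine csSup_le' ?_
  rintro s ⟨f, hf⟩
  exact (Nat.pow_le_pow_iff_right hp.out.one_lt).1 ((pow_le_card_of_injective p H f hf).trans h)

theorem le_pRank {p : ℕ} [hp : Fact p.Prime] {H : Type*} [Group H] [Finite H] {r : ℕ}
    (f : Multiplicative (Fin r → ZMod p) →* H) (hf : Function.Injective f) : r ≤ pRank p H := by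
  -- A bound is needed, since `sSup` of an unbounded set of naturals is 0.
  refine le_csSup ⟨Nat.card H, ?_⟩ ⟨f, hf⟩
  rintro s ⟨g, hg⟩
  exact (Nat.lt_pow_self hp.out.one_lt).le.trans (pow_le_card_of_injective p H g hg)

open PowerSeries

variable {k : Type*} [Field k] {G : Subgroup (k⟦X⟧ ≃ₐ[k] k⟦X⟧)}

/-- The order of `σ(z) - z`. -/
def depth (σ : G) : ℕ∞ := (σ • (X : k⟦X⟧) - X).order

theorem depth_eq_top_iff {σ : G} : depth σ = ⊤ ↔ σ = 1 := by
  rw [depth, order_eq_top, sub_eq_zero]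
  constructor
  · intro h
    exact smul_X_injective (k := k) (Γ := G) (by simpa using h)
  · rintro rfl
    rw [one_smul]

theorem min_depth_le (σ τ : G) : min (depth σ) (depth τ) ≤ depth (σ * τ) := by
  have h : (σ * τ) • (X : k⟦X⟧) - X = σ • (τ • X - X) + (σ • X - X) := by
    rw [mul_smul, smul_sub]; ring
  rw [depth, depth, depth, h, min_comm]
  refine le_trans (le_of_eq ?_) (min_order_le_order_add _ _)
  rw [order_smul]

theorem depth_inv (σ : G) : depth σ⁻¹ = depth σ := by
  have h : σ • (X : k⟦X⟧) - X = -(σ • (σ⁻¹ • X - X)) := by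
    rw [smul_sub, smul_inv_smul]; ring
  rw [depth, depth, h, order_neg, order_smul]

theorem mem_lowerRamificationGroup {j : ℕ} {σ : G} :
    σ ∈ lowerRamificationGroup G j ↔ ((j + 1 : ℕ) : ℕ∞) ≤ depth σ := by
  rw [lowerRamificationGroup, AddSubgroup.mem_inertia, depth]
  simp only [Submodule.mem_toAddSubgroup]
  rw [maximalIdeal_eq_span_X, Ideal.span_singleton_pow]
  simp only [Ideal.mem_span_singleton]
  rw [← order_X_pow (R := k) (j + 1), ← dvd_iff_order_le]
  exact ⟨fun h => h X, fun h x => h.trans (smul_sub_self_dvd σ x)⟩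

variable {p n : ℕ}

open Classical in
/-- The function `depth` in the coordinates `e`, truncated at the identity. -/
def coordDepth [Fintype G] (e : G ≃ (Fin n → ZMod p)) (v : Fin n → ZMod p) : ℕ :=
  -- The cap exceeds every finite depth, so only the infinite depth of the identity is changed and 0
  -- remains the strict maximum.
  (min ((1 + ∑ σ : G, (depth σ).toNat : ℕ) : ℕ∞) (depth (e.symm v))).toNat

variable [Fintype G] (e : G ≃ (Fin n → ZMod p)) (he : ∀ σ τ, e (σ * τ) = e σ + e τ)

theorem coe_coordDepth (v : Fin n → ZMod p) : (coordDepth e v : ℕ∞) =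
    min ((1 + ∑ σ : G, (depth σ).toNat : ℕ) : ℕ∞) (depth (e.symm v)) :=
  ENat.natCast_toNat (ne_top_of_le_ne_top (ENat.natCast_ne_top _) (min_le_left _ _))

include he

theorem coe_coordDepth_of_ne_zero {v : Fin n → ZMod p} (hv : v ≠ 0) :
    (coordDepth e v : ℕ∞) = depth (e.symm v) ∧
      coordDepth e v < 1 + ∑ σ : G, (depth σ).toNat := by
  have hne : depth (e.symm v) ≠ ⊤ := fun h => hv (by
    rw [← e.apply_symm_apply v, depth_eq_top_iff.1 h, coord_one e he])
  have hlt : (depth (e.symm v)).toNat < 1 + ∑ σ : G, (depth σ).toNat := by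
    have := Finset.single_le_sum (f := fun σ : G => (depth σ).toNat) (fun _ _ => Nat.zero_le _)
      (Finset.mem_univ (e.symm v))
    omega
  have h1 : (coordDepth e v : ℕ∞) = depth (e.symm v) := by
    rw [coe_coordDepth, min_eq_right]
    rw [← ENat.natCast_toNat hne]
    exact_mod_cast hlt.le
  refine ⟨h1, ?_⟩
  rw [← h1, ENat.toNat_natCast] at hlt
  exact hlt

theorem coordDepth_zero : coordDepth e 0 = 1 + ∑ σ : G, (depth σ).toNat := by
  have h := coe_coordDepth e 0
  rw [show e.symm 0 = 1 by rw [Equiv.symm_apply_eq, coord_one e he],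
    depth_eq_top_iff.2 rfl, min_top_right] at h
  exact_mod_cast h

theorem coordDepth_add (u v : Fin n → ZMod p) :
    min (coordDepth e u) (coordDepth e v) ≤ coordDepth e (u + v) := by
  have h1 := min_depth_le (e.symm u) (e.symm v)
  rw [← coord_symm_add e he] at h1
  have h2 : min (coordDepth e u : ℕ∞) (coordDepth e v) ≤ coordDepth e (u + v) := by
    simp only [coe_coordDepth]
    refine le_min ((min_le_left _ _).trans (min_le_left _ _)) (le_trans ?_ h1)
    exact min_le_min (min_le_right _ _) (min_le_right _ _)
  rcases le_total (coordDepth e u) (coordDepth e v) with h | h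
  · rw [min_eq_left (Nat.cast_le.2 h), Nat.cast_le] at h2
    exact (min_le_left _ _).trans h2
  · rw [min_eq_right (Nat.cast_le.2 h), Nat.cast_le] at h2
    exact (min_le_right _ _).trans h2

theorem coordDepth_neg (v : Fin n → ZMod p) : coordDepth e (-v) = coordDepth e v := by
  have : e.symm (-v) = (e.symm v)⁻¹ := e.injective (by rw [coord_inv e he]; simp)
  rw [coordDepth, coordDepth, this, depth_inv]

open Classical in
theorem sum_coordDepth_of_hasConductor [Fact p.Prime] [CharP k p] {a : Fin n → ZMod p} {c : ℕ}
    (hc : HasConductor p G (hyperplane e he a) (c + 1)) {s : Fin n → ZMod p} (hs : a ⬝ᵥ s ≠ 0) :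
    ∑ h with a ⬝ᵥ h = 0, coordDepth e (s + h) =
      (Finset.univ.filter fun h => a ⬝ᵥ h = 0).card * (c + 1) := by
  have ha : a ≠ 0 := by rintro rfl; simp at hs
  have h1 := sum_order_of_hasConductor (pow_eq_one_of_coord e he) (index_hyperplane ha) hc
    (s := e.symm s) (by rwa [mem_hyperplane, Equiv.apply_symm_apply])
  have h2 : ∀ f : (Fin n → ZMod p) → ℕ, ∑ h with a ⬝ᵥ h = 0, f h =
      ∑ h : hyperplane e he a, f (e h) := fun f => by
    refine (Finset.sum_bij (fun (h : hyperplane e he a) _ => e h) (fun h _ => ?_) (fun h _ h' _ hh => ?_)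
      (fun v hv => ?_) fun h _ => rfl).symm
    · exact Finset.mem_filter.2 ⟨Finset.mem_univ _, mem_hyperplane.1 h.2⟩
    · exact Subtype.ext (e.injective hh)
    · refine ⟨⟨e.symm v, ?_⟩, Finset.mem_univ _, by simp⟩
      rw [mem_hyperplane, Equiv.apply_symm_apply]
      exact (Finset.mem_filter.1 hv).2
  rw [Finset.card_eq_sum_ones, h2, h2, ← Finset.card_eq_sum_ones, Finset.card_univ]
  have h3 : ∀ h : hyperplane e he a, (coordDepth e (s + e h) : ℕ∞) =
      (e.symm s • (h : G) • (X : k⟦X⟧) - X).order := fun h => by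
    have hne : s + e h ≠ 0 := fun h0 => hs (by
      have h4 := congrArg (a ⬝ᵥ ·) h0
      simp only [dotProduct_add, dotProduct_zero] at h4
      rwa [mem_hyperplane.1 h.2, add_zero] at h4)
    rw [(coe_coordDepth_of_ne_zero e he hne).1, coord_symm_add e he, Equiv.symm_apply_apply,
      depth, mul_smul]
  have h5 : ((∑ h : hyperplane e he a, coordDepth e (s + e h) : ℕ) : ℕ∞) =
      ((Fintype.card (hyperplane e he a) * (c + 1) : ℕ) : ℕ∞) := by
    rw [← h1, Nat.cast_sum]
    exact Finset.sum_congr rfl fun h _ => h3 h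
  exact_mod_cast h5

section Jumps

variable [Fact p.Prime] {M : Fin n → ℕ}
  (hMv : ∀ l v, v l ≠ 0 → (∀ r < l, v r = 0) → coordDepth e v = M l)

include hMv

/-- Membership in the j-th group means depth at least j + 1 > M l, which forces the first l + 1
coordinates to vanish. -/
theorem pRank_lowerRamificationGroup_le {l : Fin n} {j : ℕ} (hM : Monotone M) (hj : M l ≤ j) :
    pRank p (lowerRamificationGroup G j) ≤ n - l - 1 := by
  refine pRank_le ?_
  have hvan : ∀ σ ∈ lowerRamificationGroup G j, ∀ r : Fin n, (r : ℕ) < l + 1 → e σ r = 0 := by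
    intro σ hσ r hr
    by_contra hne
    have h0 : e σ ≠ 0 := fun h => hne (by rw [h]; rfl)
    obtain ⟨i, hi, hi'⟩ := exists_first_ne_zero h0
    have hir : i ≤ r := by
      by_contra! hlt
      exact hne (hi' r hlt)
    have h1 := (coe_coordDepth_of_ne_zero e he h0).1
    rw [Equiv.symm_apply_apply, hMv i _ hi hi'] at h1
    rw [mem_lowerRamificationGroup, ← h1, Nat.cast_le] at hσ
    have h2 : i ≤ l := by
      rw [Fin.le_def] at hir ⊢
      omega
    have := hM h2
    omega
  have hcf := card_filter_vanishing (F := ZMod p) n (l + 1)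
  rw [ZMod.card] at hcf
  have := Fintype.ofFinite (lowerRamificationGroup G j)
  rw [Nat.sub_sub, ← hcf, Nat.card_eq_fintype_card, ← Fintype.card_coe]
  refine Fintype.card_le_of_injective (fun σ => ⟨e σ, ?_⟩) fun σ τ h => ?_
  · simpa using hvan σ σ.2
  · exact Subtype.ext (e.injective (congrArg Subtype.val h))

/-- Vectors whose first l coordinates vanish have depth at least M l, so they give a copy of
(ℤ/p)^(n-l) in the group. -/
theorem le_pRank_lowerRamificationGroup {l : Fin n} {j : ℕ} (hM : Monotone M) (hj : j < M l) :
    n - l ≤ pRank p (lowerRamificationGroup G j) := by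
  let ext : (Fin (n - l) → ZMod p) → Fin n → ZMod p := fun v r =>
    if h : (l : ℕ) ≤ r then v ⟨r - l, by omega⟩ else 0
  have hext0 : ∀ v r, r < l → ext v r = 0 := fun v r hr =>
    dif_neg (by rw [Fin.lt_def] at hr; omega)
  have hextadd : ∀ u v, ext (u + v) = ext u + ext v := fun u v => by
    ext r
    simp only [ext, Pi.add_apply]
    split_ifs <;> simp
  have hmem : ∀ v, e.symm (ext v) ∈ lowerRamificationGroup G j := fun v => by
    rw [mem_lowerRamificationGroup]
    by_cases h0 : ext v = 0
    · rw [h0, show e.symm 0 = 1 by rw [Equiv.symm_apply_eq, coord_one e he],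
        depth_eq_top_iff.2 rfl]
      exact le_top
    · obtain ⟨i, hi, hi'⟩ := exists_first_ne_zero h0
      rw [← (coe_coordDepth_of_ne_zero e he h0).1, hMv i _ hi hi', Nat.cast_le]
      have h2 : l ≤ i := by
        by_contra! hlt
        exact hi (hext0 v i hlt)
      have := hM h2
      omega
  refine le_pRank (r := n - l)
    { toFun := fun v => ⟨e.symm (ext (Multiplicative.toAdd v)), hmem _⟩
      map_one' := by
        refine Subtype.ext (e.injective ?_)
        change e (e.symm (ext 0)) = e 1
        rw [Equiv.apply_symm_apply, coord_one e he]
        ext r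
        simp [ext]
      map_mul' := fun u v => by
        refine Subtype.ext ?_
        change e.symm (ext (Multiplicative.toAdd u + Multiplicative.toAdd v)) = _
        rw [hextadd, coord_symm_add e he]
        rfl } ?_
  intro u v huv
  have h1 : ext (Multiplicative.toAdd u) = ext (Multiplicative.toAdd v) :=
    e.symm.injective (congrArg Subtype.val huv)
  refine Multiplicative.toAdd.injective ?_
  ext i
  have h2 := congrFun h1 ⟨l + i, by omega⟩
  have h3 : l ≤ (⟨l + i, by omega⟩ : Fin n) := by simp [Fin.le_def]
  simpa [ext, h3] using h2

theorem isLowerJump_iff {l : Fin n} (hM : Monotone M) {j j' : ℕ} (hj : M l = j + 1) (hj0 : 0 < j) :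
    IsLowerJump p n G l j' ↔ j' = j := by
  have hl := l.2
  constructor
  · rintro ⟨-, h1, h2⟩
    by_contra hne
    rcases lt_or_gt_of_ne hne with h | h
    · have := le_pRank_lowerRamificationGroup e he hMv (l := l) (j := j' + 1) hM (by omega)
      omega
    · have := pRank_lowerRamificationGroup_le e he hMv (l := l) (j := j') hM (by omega)
      omega
  · rintro rfl
    exact ⟨hj0, le_pRank_lowerRamificationGroup e he hMv hM (by omega),
      pRank_lowerRamificationGroup_le e he hMv hM (by omega)⟩

end Jumps

end LocalCover

end

/-! ### Assembly of the theorem. -/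

theorem lemma3 (p : ℕ) [Fact p.Prime] (k : Type*) [Field k] [IsAlgClosed k] [CharP k p]
    (n : ℕ) (G : Subgroup (k⟦X⟧ ≃ₐ[k] k⟦X⟧))
    (hG : Nonempty (G ≃* Multiplicative (Fin n → ZMod p)))
    (m : Fin n → ℕ) (N : Fin n → Subgroup G) (hm : LocalCover.IsCoverOfType p G m N) :
    (∀ l : Fin n, ∃ j : ℕ,
      (j : ℤ) = (p : ℤ) ^ (l : ℕ) * m l
        - ((p : ℤ) - 1) * ∑ i ∈ Finset.Iio l, (p : ℤ) ^ (i : ℕ) * m i ∧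
      ∀ j' : ℕ, LocalCover.IsLowerJump p n G l j' ↔ j' = j) ∧
    differentIdeal (LocalCover.invariants G) k⟦X⟧ =
      IsLocalRing.maximalIdeal k⟦X⟧ ^ ((p - 1) * ∑ l : Fin n, p ^ (l : ℕ) * (m l + 1)) := by
  classical
  have : Finite G := by
    obtain ⟨g⟩ := hG
    exact Finite.of_equiv (Fin n → ZMod p) (g.toEquiv.trans Multiplicative.toAdd).symm
  have := Fintype.ofFinite G
  obtain ⟨e, w, he, hwK, hew, hN⟩ := hm.admissible.exists_coordinates hG
  have hcond : ∀ a : Fin n → ZMod p, ∃ c, a ≠ 0 →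
      LocalCover.HasConductor p G (LocalCover.hyperplane e he a) (c + 1) ∧
        ∀ i, a = Pi.single i 1 → c = m i := by
    intro a
    by_cases ha : a = 0
    · exact ⟨0, fun h => absurd ha h⟩
    -- Prescribing m i for the i-th coordinate hyperplane avoids having to compare two conductors of
    -- the same extension.
    by_cases hi : ∃ i, a = Pi.single i 1
    · obtain ⟨i, rfl⟩ := hi
      refine ⟨m i, fun _ => ⟨?_, fun i' hi' => ?_⟩⟩
      · have : LocalCover.hyperplane e he (Pi.single i 1) = N i := by
          ext σ
          rw [LocalCover.mem_hyperplane, hN, single_dotProduct, one_mul]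
        rw [this]
        exact hm.admissible.conductor i
      · have h1 := congrFun hi' i
        by_cases hii : i = i'
        · rw [hii]
        · simp [Pi.single_eq_of_ne hii] at h1
    · obtain ⟨c, hc⟩ := LocalCover.exists_hasConductor_hyperplane (he := he) hwK hew ha
      exact ⟨c, fun _ => ⟨hc, fun i h => absurd ⟨i, h⟩ hi⟩⟩
  choose c hc using hcond
  obtain ⟨M, hM, hMv, hMf, hsum⟩ := filtration_of_conductors (LocalCover.coordDepth e)
    (LocalCover.coordDepth_add e he) (LocalCover.coordDepth_neg e he)
    (fun v hv => by
      rw [LocalCover.coordDepth_zero e he]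
      exact (LocalCover.coe_coordDepth_of_ne_zero e he hv).2)
    m c (fun i => (hc _ (by simp)).2 i rfl)
    (fun a l j hlj haj => hm.le_conductor hN hlj haj
      (hc a (by rintro rfl; exact haj rfl)).1)
    (fun a s has => LocalCover.sum_coordDepth_of_hasConductor e he
      (hc a (by rintro rfl; simp at has)).1 has)
  constructor
  · intro l
    -- Wild ramification makes the jump M l - 1 positive.
    have h2 : 2 ≤ M l := by
      have hne : (Pi.single l 1 : Fin n → ZMod p) ≠ 0 := by simp
      have h1 := (LocalCover.coe_coordDepth_of_ne_zero e he hne).1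
      rw [hMv l _ (by simp) (fun r hr => Pi.single_eq_of_ne hr.ne _)] at h1
      have h3 := PowerSeries.dvd_iff_order_le.1 (PowerSeries.X_sq_dvd_smul_X_sub_X (k := k)
        (LocalCover.pow_eq_one_of_coord e he (e.symm (Pi.single l 1))))
      rw [PowerSeries.order_X_pow] at h3
      exact_mod_cast h3.trans_eq h1.symm
    refine ⟨M l - 1, ?_, fun j' => ?_⟩
    · have := hMf l
      push_cast [show 1 ≤ M l by omega]
      linear_combination this
    · exact LocalCover.isLowerJump_iff e he hMv hM (by omega) (by omega)
  · rw [← hsum]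
    have h := PowerSeries.differentIdeal_invariants (k := k) (Γ := G)
    rw [LocalCover.invariants, h]
    congr 1
    simp only [Finset.sum_filter]
    refine Finset.sum_equiv e (by simp) fun σ _ => ?_
    by_cases hσ : σ = 1
    · simp [hσ, LocalCover.coord_one e he]
    · have hne : e σ ≠ 0 := fun h0 =>
        hσ (e.injective (h0.trans (LocalCover.coord_one e he).symm))
      rw [if_pos hσ, if_pos hne]
      have h1 := (LocalCover.coe_coordDepth_of_ne_zero e he hne).1
      rw [Equiv.symm_apply_apply] at h1
      change (LocalCover.depth σ).toNat = _
      rw [← h1, ENat.toNat_natCast]
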